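/- For $n \ge 0$, a parking function of length $n$ is a vector $(p_1,\dots,p_n)$ of integers with $1\le p_i\le n$ whose weakly increasing rearrangement $p_{(1)}\le\dots\le p_{(n)}$ satisfies $p_{(i)}\le i$ for $1\le i\le n$; its area is $\mathrm{Area}(p)=\frac{n(n+1)}{2}-\sum_{i=1}^n p_i$. Let $E_k(n)$ be the $k$-th factorial moment of the area over all parking functions of length $n$ (uniformly distributed), i.e. the average of $\mathrm{Area}(p)(\mathrm{Area}(p)-1)\cdots(\mathrm{Area}(p)-k+1)$. Then for every $n$ the third factorial moment is $$E_3(n) = -\frac{175}{192}n^4-\frac{283}{192}n^3+\frac{199}{192}n^2+\frac{259}{192}n+\left(\frac{15}{32}n^3+\frac{521}{96}n^2+\frac{1219}{96}n+\frac{743}{96}\right)E_1(n),$$ where $E_1(n)$ is the expectation of the area, given explicitly by $$E_1(n) = -\frac n2+\frac12\,\frac{(n+1)!}{(n+1)^n}\sum_{k=0}^{n-1}\frac{(n+1)^k}{k!}.$$ Asymptotically, as $n\to\infty$, $$E_3(n)=\frac{15}{128}\sqrt{2\pi}\;n^{9/2}+O(n^4).$$ -/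

import Mathlib

open Filter Asymptotics
open scoped Nat

namespace ParkingArea

/-- The vector `(p 0, …, p (n-1))` of integers with `1 ≤ p i ≤ n` is a parking function of
length `n` if its weakly increasing rearrangement `p_(1) ≤ ⋯ ≤ p_(n)` satisfies `p_(i) ≤ i`.
Entries are indexed from `0`, so `p_(i+1)` is the entry `i` of `p ∘ Tuple.sort p`. -/
def IsParkingFunction (n : ℕ) (p : Fin n → ℕ) : Prop :=
  (∀ i, 1 ≤ p i ∧ p i ≤ n) ∧ ∀ i : Fin n, (p ∘ Tuple.sort p) i ≤ (i : ℕ) + 1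

instance (n : ℕ) : DecidablePred (IsParkingFunction n) := fun p =>
  inferInstanceAs (Decidable
    ((∀ i, 1 ≤ p i ∧ p i ≤ n) ∧ ∀ i : Fin n, (p ∘ Tuple.sort p) i ≤ (i : ℕ) + 1))

/-- The finite set of parking functions of length `n`. -/
def parkingFunctions (n : ℕ) : Finset (Fin n → ℕ) :=
  (Fintype.piFinset fun _ : Fin n => Finset.Icc 1 n).filter (IsParkingFunction n)

theorem mem_parkingFunctions {n : ℕ} {p : Fin n → ℕ} :
    p ∈ parkingFunctions n ↔ IsParkingFunction n p := by
  simp only [parkingFunctions, Finset.mem_filter, Fintype.mem_piFinset, Finset.mem_Icc]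
  exact ⟨fun h => h.2, fun h => ⟨h.1, h⟩⟩

/-- The area statistic `n (n + 1) / 2 - (p_1 + ⋯ + p_n)`, as a real number. -/
noncomputable def area {n : ℕ} (p : Fin n → ℕ) : ℝ :=
  (n : ℝ) * ((n : ℝ) + 1) / 2 - ∑ i, (p i : ℝ)

/-- The expectation of `X` over a uniformly random parking function of length `n`. -/
noncomputable def expectation (n : ℕ) (X : (Fin n → ℕ) → ℝ) : ℝ :=
  (∑ p ∈ parkingFunctions n, X p) / ((parkingFunctions n).card : ℝ)

/-- `E_k(n)`: the `k`-th factorial moment of the area, that is, the expectation of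
`area * (area - 1) * ⋯ * (area - k + 1)`, over parking functions of length `n`. -/
noncomputable def factorialMoment (k n : ℕ) : ℝ :=
  expectation n fun p => ∏ j ∈ Finset.range k, (area p - (j : ℝ))

end ParkingArea

/-! Let P_k(q) enumerate parking functions of length k by the sum of their entries. A word of length
n in the letters 1, …, N (with N ≥ n) has a first empty spot k + 1: k of its cars form a parking
function, and the other letters are arbitrary above k + 1. Binomial inversion of this decomposition
(`sum_choose_mul_sumEnumerator`) gives ∑ C(n,k) P_k(q) (-(q + ⋯ + q^(k+1)))^(n-k) = [n = 0].

Differentiating j ≤ 3 times at q = 1 gives recurrences for the factorial moments of the sum of the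
entries. They become linear equations between the series `abelSeries a` = ∑ a_k z^k/k! e^(-(k+1)z),
and a ↦ `abelSeries a` is injective. With g = 1/(1-z), the numbers T_k = (k+1)^(k-1) have series 1
and the Ramanujan sums R_k have series g^2. Multiplication of a_k by k + 1 becomes f ↦ g (z f)', and
z g = g - 1. So all series involved are polynomials in g. The multiples (k+1)^j T_k and (k+1)^j R_k
have series of pairwise distinct degrees that exhaust 0, 1, 2, …, so each moment is a combination of
them. As R_n/T_n is affine in E_1(n), the third moment is expressed through E_1(n).

For the asymptotics put N = n + 1. Then R_n/N^n is N!/N^N times the part of the series of e^N below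
k = N. It differs by at most 4 from the rest of the series, scaled alike, so twice it is N! e^N/N^N
+ O(1), and Stirling's formula applies. -/

namespace ParkingArea

/-! ### Parking and the first empty spot -/

/-- The cars in `s` park on the spots `1, …, #s`. -/
def Parks {ι : Type*} (s : Finset ι) (p : ι → ℕ) : Prop :=
  ∀ i ≤ s.card, i ≤ (s.filter fun j => p j ≤ i).card

theorem Parks.le_card {ι : Type*} {s : Finset ι} {p : ι → ℕ} (h : Parks s p) {j : ι}
    (hj : j ∈ s) : p j ≤ s.card := by
  have h1 := Finset.eq_of_subset_of_card_le (Finset.filter_subset _ _) (h _ le_rfl)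
  rw [← h1] at hj
  exact (Finset.mem_filter.1 hj).2

/-- The i-th smallest entry is at most i exactly when at least i entries are at most i. The bound `p
i ≤ n` then comes for free. -/
theorem isParkingFunction_iff {n : ℕ} {p : Fin n → ℕ} :
    IsParkingFunction n p ↔ (∀ i, 1 ≤ p i) ∧ Parks Finset.univ p := by
  have key : (∀ i : Fin n, (p ∘ Tuple.sort p) i ≤ (i : ℕ) + 1) ↔ Parks Finset.univ p := by
    have hc : ∀ a, (Finset.univ.filter fun i => (p ∘ Tuple.sort p) i ≤ a).card =
        (Finset.univ.filter fun i => p i ≤ a).card := fun a => by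
      refine Finset.card_equiv (Tuple.sort p) fun i => ?_
      simp
    constructor
    · intro h i hi
      rcases i with _ | i
      · exact Nat.zero_le _
      · have hi' : i < n := by simpa using hi
        have := (Tuple.lt_card_le_iff_apply_le_of_monotone (j := ⟨i, hi'⟩)
          (Tuple.monotone_sort p)).2 (h ⟨i, hi'⟩)
        rw [hc] at this
        exact this
    · intro h i
      rw [← Tuple.lt_card_le_iff_apply_le_of_monotone (Tuple.monotone_sort p), hc]
      exact h (i + 1) (by simp)
  rw [IsParkingFunction, key]
  refine ⟨fun h => ⟨fun i => (h.1 i).1, h.2⟩, fun h => ⟨fun i => ⟨h.1 i, ?_⟩, h.2⟩⟩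
  simpa using h.2.le_card (Finset.mem_univ i)

/-- The first empty spot determines the cars that park before it. -/
theorem existsUnique_parks {ι : Type*} [Fintype ι] (p : ι → ℕ) :
    ∃! s : Finset ι, Parks s p ∧ ∀ j ∉ s, s.card + 2 ≤ p j := by
  classical
  have hex : ∃ k, (Finset.univ.filter fun j => p j ≤ k + 1).card ≤ k :=
    ⟨Fintype.card ι, Finset.card_filter_le _ _⟩
  refine existsUnique_of_exists_of_unique ?_ ?_
  -- Spot k + 1 is the first empty one. By minimality at least i cars prefer spots up to i for each
  -- i ≤ k; comparing with k + 1, no car prefers k + 1.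
  · obtain ⟨k, hk, hmin⟩ : ∃ k, (Finset.univ.filter fun j => p j ≤ k + 1).card ≤ k ∧
        ∀ i < k, ¬ (Finset.univ.filter fun j => p j ≤ i + 1).card ≤ i :=
      ⟨Nat.find hex, Nat.find_spec hex, fun i hi => Nat.find_min hex hi⟩
    have hge : ∀ i ≤ k, i ≤ (Finset.univ.filter fun j => p j ≤ i).card := by
      rintro (_ | i) hi
      · exact Nat.zero_le _
      · have := hmin i hi
        omega
    have hsub : (Finset.univ.filter fun j => p j ≤ k) ⊆
        Finset.univ.filter fun j => p j ≤ k + 1 := fun j => by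
      simp only [Finset.mem_filter, Finset.mem_univ, true_and]; omega
    have heq := Finset.eq_of_subset_of_card_le hsub (hk.trans (hge k le_rfl))
    have hcard : (Finset.univ.filter fun j => p j ≤ k).card = k :=
      le_antisymm (heq ▸ hk) (hge k le_rfl)
    refine ⟨Finset.univ.filter fun j => p j ≤ k, fun i hi => ?_, fun j hj => ?_⟩
    · rw [hcard] at hi
      refine (hge i hi).trans (Finset.card_le_card fun j => ?_)
      simp only [Finset.mem_filter, Finset.mem_univ, true_and]; omega
    · rw [hcard]
      have h1 : ¬ p j ≤ k + 1 := by
        rw [heq] at hj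
        simpa using hj
      omega
  · have hle : ∀ s t : Finset ι, (Parks s p ∧ ∀ j ∉ s, s.card + 2 ≤ p j) → Parks t p →
        t.card ≤ s.card := by
      intro s t hs ht
      by_contra! hlt
      have h1 := ht _ hlt
      -- If t were larger, at least `s.card + 1` of its cars would prefer spots up to `s.card + 1`,
      -- but all such cars lie in s.
      have h2 : (t.filter fun j => p j ≤ s.card + 1) ⊆ s := fun j hj => by
        by_contra hjs
        have h3 := hs.2 j hjs
        have h4 := (Finset.mem_filter.1 hj).2
        omega
      have := h1.trans (Finset.card_le_card h2)
      omega
    intro s t hs ht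
    have hst := le_antisymm (hle t s ht hs.1) (hle s t hs ht.1)
    refine Finset.eq_of_subset_of_card_le (fun j hj => ?_) hst.ge
    by_contra hjt
    have h1 := ht.2 j hjt
    have h2 := hs.1.le_card hj
    omega

/-! ### Sum enumerators and binomial inversion -/

/-- The enumerator of parking functions of length `n` by the sum of their entries. -/
def sumEnumerator {R : Type*} [CommSemiring R] (q : R) (n : ℕ) : R :=
  ∑ p ∈ parkingFunctions n, ∏ i, q ^ p i

-- A word with parked set s splits into a parking function, its restriction to s relabelled by
-- `s.equivFin`, and a free word off s.
open Classical in
theorem sum_filter_parks {R : Type*} [CommSemiring R] (q : R) {n N : ℕ} (hN : n ≤ N)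
    (s : Finset (Fin n)) :
    ∑ p ∈ (Fintype.piFinset fun _ : Fin n => Finset.Icc 1 N).filter
        (fun p => Parks s p ∧ ∀ j ∉ s, s.card + 2 ≤ p j), ∏ i, q ^ p i =
      sumEnumerator q s.card * (∑ i ∈ Finset.Icc (s.card + 2) N, q ^ i) ^ (n - s.card) := by
  have hcard : Fintype.card {j // j ∉ s} = n - s.card := by
    simp [Fintype.card_subtype_compl]
  have hs : s.card ≤ n := by simpa using s.card_le_univ
  rw [← hcard, ← Finset.card_univ, ← Finset.prod_const, Finset.prod_univ_sum, sumEnumerator,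
    Finset.sum_mul_sum, ← Finset.sum_product']
  have hparks : ∀ p : Fin n → ℕ,
      Parks Finset.univ (fun i => p (s.equivFin.symm i)) ↔ Parks s p := by
    intro p
    have : ∀ a, (Finset.univ.filter fun i => p (s.equivFin.symm i) ≤ a).card =
        (s.filter fun j => p j ≤ a).card := by
      intro a
      refine Finset.card_bij (fun i _ => (s.equivFin.symm i : Fin n)) ?_ ?_ ?_
      · intro i hi
        simpa using hi
      · intro i _ j _ hij
        exact s.equivFin.symm.injective (Subtype.ext hij)
      · intro j hj
        rw [Finset.mem_filter] at hj
        exact ⟨s.equivFin ⟨j, hj.1⟩, by simpa using hj.2, by simp⟩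
    simp [Parks, this]
  refine Finset.sum_nbij'
    (fun p => (fun i => p (s.equivFin.symm i), fun j => p j))
    (fun ab j => if h : j ∈ s then ab.1 (s.equivFin ⟨j, h⟩) else ab.2 ⟨j, h⟩) ?_ ?_ ?_ ?_ ?_
  · intro p hp
    simp only [Finset.mem_filter, Fintype.mem_piFinset, Finset.mem_Icc] at hp
    simp only [Finset.mem_product, mem_parkingFunctions, isParkingFunction_iff,
      Fintype.mem_piFinset, Finset.mem_Icc, hparks]
    exact ⟨⟨fun i => (hp.1 _).1, hp.2.1⟩, fun j => ⟨hp.2.2 j j.2, (hp.1 _).2⟩⟩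
  · rintro ⟨a, b⟩ hab
    simp only [Finset.mem_product, mem_parkingFunctions, isParkingFunction_iff,
      Fintype.mem_piFinset, Finset.mem_Icc] at hab
    simp only [Finset.mem_filter, Fintype.mem_piFinset, Finset.mem_Icc, ← hparks]
    obtain ⟨⟨ha, ha'⟩, hb⟩ := hab
    refine ⟨fun j => ?_, ?_, fun j hj => ?_⟩
    · by_cases hj : j ∈ s
      · have h1 := ha'.le_card (Finset.mem_univ (s.equivFin ⟨j, hj⟩))
        rw [Finset.card_univ, Fintype.card_fin] at h1
        simpa [hj] using ⟨ha _, h1.trans (hs.trans hN)⟩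
      · have := hb ⟨j, hj⟩
        simp only [hj, dite_false]
        omega
    · simpa using ha'
    · simpa [hj] using (hb ⟨j, hj⟩).1
  · intro p _
    ext j
    by_cases hj : j ∈ s <;> simp [hj]
  · rintro ⟨a, b⟩ _
    ext j
    · simp
    · simp [j.2]
  · intro p _
    rw [← Fintype.prod_subtype_mul_prod_subtype (fun j => j ∈ s)]
    congr 1
    convert (Equiv.prod_comp s.equivFin.symm fun j : {j // j ∈ s} => q ^ p j).symm

/-- Decomposition of all words at the first empty spot. -/
theorem sum_pow_eq_sum_sumEnumerator {R : Type*} [CommSemiring R] (q : R) {n N : ℕ}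
    (hN : n ≤ N) :
    (∑ i ∈ Finset.Icc 1 N, q ^ i) ^ n = ∑ k ∈ Finset.range (n + 1), (n.choose k : R) *
      (sumEnumerator q k * (∑ i ∈ Finset.Icc (k + 2) N, q ^ i) ^ (n - k)) := by
  classical
  have h1 := Finset.sum_powerset_apply_card (x := (Finset.univ : Finset (Fin n)))
    (fun k => sumEnumerator q k * (∑ i ∈ Finset.Icc (k + 2) N, q ^ i) ^ (n - k))
  rw [Finset.card_univ, Fintype.card_fin] at h1
  simp_rw [nsmul_eq_mul] at h1
  rw [← h1, Finset.powerset_univ]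
  simp_rw [← sum_filter_parks q hN, Finset.sum_filter]
  rw [Finset.sum_comm]
  have h2 := Finset.prod_univ_sum (fun _ : Fin n => Finset.Icc 1 N) (fun _ i => q ^ i)
  rw [Finset.prod_const, Finset.card_univ, Fintype.card_fin] at h2
  rw [h2]
  refine Finset.sum_congr rfl fun p _ => ?_
  obtain ⟨s, hs, huniq⟩ := existsUnique_parks p
  rw [Finset.sum_eq_single s]
  · rw [if_pos hs]
  · intro t _ ht
    exact if_neg fun h => ht (huniq t h)
  · simp

/-- The signed linear recurrence for the sum enumerators. -/
theorem sum_choose_mul_sumEnumerator {R : Type*} [CommRing R] (q : R) (n : ℕ) :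
    ∑ k ∈ Finset.range (n + 1), (n.choose k : R) *
      (sumEnumerator q k * (-∑ i ∈ Finset.range (k + 1), q ^ (i + 1)) ^ (n - k)) =
      if n = 0 then 1 else 0 := by
  -- With N = n + 1 and h_k = -(q + ⋯ + q^(k+1)), the tail is x + h_k. Convolving the decompositions
  -- of x^m, m ≤ n, with C(n,m) (-x)^(n-m) turns (x + h_k)^(m-k) into h_k^(n-k), and the powers x^m
  -- into (x - x)^n.
  set x : R := ∑ i ∈ Finset.Icc 1 (n + 1), q ^ i with hx
  have hsplit : ∀ k ≤ n, ∑ i ∈ Finset.Icc (k + 2) (n + 1), q ^ i =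
      x + -∑ i ∈ Finset.range (k + 1), q ^ (i + 1) := by
    intro k hk
    have h1 : ∀ m, ∑ i ∈ Finset.range m, q ^ (i + 1) = ∑ i ∈ Finset.Ico 1 (m + 1), q ^ i := by
      intro m
      rw [Finset.range_eq_Ico, Finset.sum_Ico_add' (fun i => q ^ i)]
    have h2 : Finset.Icc (k + 2) (n + 1) = Finset.Ico (k + 2) (n + 2) := rfl
    have h3 : Finset.Icc 1 (n + 1) = Finset.Ico 1 (n + 2) := rfl
    rw [h1, hx, h2, h3, ← Finset.sum_Ico_consecutive _ (show 1 ≤ k + 2 by omega)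
      (show k + 2 ≤ n + 2 by omega)]
    ring
  have hinv : ∀ k ≤ n, ∑ m ∈ Finset.range (n + 1), (n.choose m : R) * (-x) ^ (n - m) *
      ((m.choose k : R) *
        (x + -∑ i ∈ Finset.range (k + 1), q ^ (i + 1)) ^ (m - k)) =
      (n.choose k : R) * (-∑ i ∈ Finset.range (k + 1), q ^ (i + 1)) ^ (n - k) := by
    intro k hk
    set h := -∑ i ∈ Finset.range (k + 1), q ^ (i + 1)
    have h0 : h = (x + h) + -x := by ring
    conv_rhs => rw [h0, add_pow]
    rw [Finset.range_eq_Ico, ← Finset.sum_Ico_consecutive _ (Nat.zero_le k) (by omega : k ≤ n + 1),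
      Finset.sum_eq_zero, zero_add, Finset.sum_Ico_eq_sum_range, Finset.mul_sum]
    · rw [show n + 1 - k = n - k + 1 by omega]
      refine Finset.sum_congr rfl fun l hl => ?_
      have hl' : l ≤ n - k := by simpa [Nat.lt_succ_iff] using hl
      have hc : (n.choose (k + l) : R) * ((k + l).choose k : R) =
          (n.choose k : R) * ((n - k).choose l : R) := by
        have := Nat.choose_mul (n := n) (k := k + l) (s := k) (by omega)
        rw [Nat.add_sub_cancel_left] at this
        rw [← Nat.cast_mul, this, Nat.cast_mul]
      rw [show n - k - l = n - (k + l) by omega, Nat.add_sub_cancel_left]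
      linear_combination (-x) ^ (n - (k + l)) * (x + h) ^ l * hc
    · intro m hm
      rw [Nat.choose_eq_zero_of_lt (Finset.mem_Ico.1 hm).2]
      simp
  have hall : ∀ m ≤ n, x ^ m = ∑ k ∈ Finset.range (n + 1), (m.choose k : R) *
      (sumEnumerator q k * (x + -∑ i ∈ Finset.range (k + 1), q ^ (i + 1)) ^ (m - k)) := by
    intro m hm
    rw [hx, sum_pow_eq_sum_sumEnumerator q (show m ≤ n + 1 by omega)]
    have hsub : Finset.range (m + 1) ⊆ Finset.range (n + 1) :=
      Finset.range_subset_range.2 (by omega)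
    rw [← Finset.sum_subset hsub]
    · refine Finset.sum_congr rfl fun k hk => ?_
      rw [hsplit k (by have := Finset.mem_range.1 hk; omega)]
    · intro k _ hk
      rw [Nat.choose_eq_zero_of_lt (by simpa using hk)]
      simp
  calc _ = ∑ k ∈ Finset.range (n + 1), ∑ m ∈ Finset.range (n + 1),
        (n.choose m : R) * (-x) ^ (n - m) * ((m.choose k : R) *
        (sumEnumerator q k * (x + -∑ i ∈ Finset.range (k + 1), q ^ (i + 1)) ^ (m - k))) := by
        refine Finset.sum_congr rfl fun k hk => ?_
        rw [mul_left_comm, ← hinv k (by simpa [Nat.lt_succ_iff] using hk), Finset.mul_sum]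
        refine Finset.sum_congr rfl fun m _ => ?_
        ring
    _ = ∑ m ∈ Finset.range (n + 1), x ^ m * (-x) ^ (n - m) * (n.choose m : R) := by
        rw [Finset.sum_comm]
        refine Finset.sum_congr rfl fun m hm => ?_
        rw [hall m (by simpa [Nat.lt_succ_iff] using hm), ← Finset.mul_sum]
        ring
    _ = _ := by
        rw [← add_pow, add_neg_cancel, zero_pow_eq]

/-! ### The Abel-type series and its special values -/

open PowerSeries in
/-- The series `∑ a k z ^ k / k! * exp (-(k + 1) z)`. -/
noncomputable def abelSeries : (ℕ → ℝ) →ₗ[ℝ] PowerSeries ℝ where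
  toFun a := PowerSeries.mk fun n => ∑ k ∈ Finset.range (n + 1),
    a k / (k ! : ℝ) * ((-((k : ℝ) + 1)) ^ (n - k) / ((n - k)! : ℝ))
  map_add' a b := by
    ext n
    simp only [coeff_mk, map_add, Pi.add_apply, ← Finset.sum_add_distrib]
    exact Finset.sum_congr rfl fun k _ => by ring
  map_smul' c a := by
    ext n
    simp only [coeff_mk, map_smul, Pi.smul_apply, smul_eq_mul, Finset.mul_sum, RingHom.id_apply]
    exact Finset.sum_congr rfl fun k _ => by ring

theorem coeff_abelSeries (a : ℕ → ℝ) (n : ℕ) :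
    PowerSeries.coeff n (abelSeries a) = ∑ k ∈ Finset.range (n + 1),
      a k / (k ! : ℝ) * ((-((k : ℝ) + 1)) ^ (n - k) / ((n - k)! : ℝ)) := by
  simp [abelSeries]

/-- The system is unitriangular up to factorials: coefficient n is a_n/n! plus terms in earlier a_k.
-/
theorem abelSeries_injective : Function.Injective abelSeries := by
  rw [injective_iff_map_eq_zero]
  intro a ha
  funext n
  induction n using Nat.strong_induction_on with
  | _ n ih =>
    have h := congrArg (PowerSeries.coeff n) ha
    rw [coeff_abelSeries, Finset.sum_range_succ, Finset.sum_eq_zero] at h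
    · have : (n ! : ℝ) ≠ 0 := by positivity
      simpa [this] using h
    · intro k hk
      rw [ih k (Finset.mem_range.1 hk)]
      simp

/-- `n!` times a coefficient of `X ^ j * abelSeries a`, written with binomial coefficients. -/
theorem factorial_mul_coeff_X_pow_mul_abelSeries (a : ℕ → ℝ) (j n : ℕ) :
    (n ! : ℝ) * PowerSeries.coeff n (PowerSeries.X ^ j * abelSeries a) =
      ∑ k ∈ Finset.range (n + 1), (n.choose k : ℝ) *
        (a k * (((n - k).descFactorial j : ℕ) * (-((k : ℝ) + 1)) ^ (n - k - j))) := by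
  rw [PowerSeries.coeff_X_pow_mul']
  split_ifs with hj
  · have hsub : Finset.range (n - j + 1) ⊆ Finset.range (n + 1) :=
      Finset.range_subset_range.2 (by omega)
    rw [coeff_abelSeries, Finset.mul_sum, ← Finset.sum_subset hsub]
    · refine Finset.sum_congr rfl fun k hk => ?_
      have hk' : k + j ≤ n := by have := Finset.mem_range.1 hk; omega
      have h1 : (n.choose k : ℝ) * (k ! * (n - k)!) = n ! := by
        rw [← mul_assoc]
        exact_mod_cast Nat.choose_mul_factorial_mul_factorial (by omega : k ≤ n)
      have h2 : ((n - k - j)! : ℝ) * ((n - k).descFactorial j : ℕ) = (n - k)! := by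
        exact_mod_cast Nat.factorial_mul_descFactorial (by omega : j ≤ n - k)
      have h3 : (k ! : ℝ) ≠ 0 := by positivity
      have h4 : ((n - k - j)! : ℝ) ≠ 0 := by positivity
      rw [show n - j - k = n - k - j by omega, ← h1, ← h2]
      field_simp
    · intro k hk hk'
      rw [Nat.descFactorial_of_lt]
      · simp
      · simp only [Finset.mem_range] at hk hk'
        omega
  · symm
    rw [mul_zero]
    refine Finset.sum_eq_zero fun k _ => ?_
    rw [Nat.descFactorial_of_lt (by omega)]
    simp

theorem factorial_mul_coeff_abelSeries (a : ℕ → ℝ) (n : ℕ) :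
    (n ! : ℝ) * PowerSeries.coeff n (abelSeries a) =
      ∑ k ∈ Finset.range (n + 1), (n.choose k : ℝ) * (a k * (-((k : ℝ) + 1)) ^ (n - k)) := by
  simpa using factorial_mul_coeff_X_pow_mul_abelSeries a 0 n

theorem sum_neg_one_pow_choose (f : ℝ → ℝ) (n : ℕ) (y : ℝ) :
    ∑ k ∈ Finset.range (n + 1), (-1) ^ (n - k) * (n.choose k : ℝ) * f (y + k) =
      (fwdDiff 1)^[n] f y := by
  rw [fwdDiff_iter_eq_sum_shift]
  simp

/-- The geometric series `1 / (1 - z)`. -/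
noncomputable def geom : PowerSeries ℝ := PowerSeries.mk 1

theorem geom_mul : geom * (1 - PowerSeries.X) = 1 := PowerSeries.mk_one_mul_one_sub_eq_one ℝ

theorem X_mul_geom_pow (m : ℕ) :
    PowerSeries.X * geom ^ (m + 1) = geom ^ (m + 1) - geom ^ m := by
  linear_combination (-geom ^ m) * geom_mul

theorem X_mul_geom : PowerSeries.X * geom = geom - 1 := by
  simpa using X_mul_geom_pow 0

theorem derivative_geom : PowerSeries.derivative ℝ geom = geom ^ 2 := by
  have h := congrArg (PowerSeries.derivative ℝ) geom_mul
  simp only [Derivation.leibniz, map_sub, Derivation.map_one_eq_zero, smul_eq_mul,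
    PowerSeries.derivative_X] at h
  linear_combination geom * h + (-PowerSeries.derivative ℝ geom) * geom_mul

/-- The operator on series that corresponds to multiplication of `a k` by `k + 1`. -/
noncomputable def succOp : PowerSeries ℝ →ₗ[ℝ] PowerSeries ℝ where
  toFun f := geom * PowerSeries.derivative ℝ (PowerSeries.X * f)
  map_add' f g := by rw [mul_add, map_add, mul_add]
  map_smul' c f := by simp [-smul_add]

theorem succOp_apply (f : PowerSeries ℝ) :
    succOp f = geom * PowerSeries.derivative ℝ (PowerSeries.X * f) := rfl

/-- With w = z e^(-z), z times the series is ∑ a_k/k! w^(k+1), and w' = (1-z) e^(-z).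
Differentiating therefore brings down k + 1 and a factor 1 - z, which `geom` cancels. -/
theorem abelSeries_succ_mul (a : ℕ → ℝ) :
    abelSeries (fun k => ((k : ℝ) + 1) * a k) = succOp (abelSeries a) := by
  have key : (1 - PowerSeries.X) * abelSeries (fun k => ((k : ℝ) + 1) * a k) =
      PowerSeries.derivative ℝ (PowerSeries.X * abelSeries a) := by
    ext n
    rw [PowerSeries.coeff_derivative, PowerSeries.coeff_succ_X_mul, sub_mul, one_mul, map_sub]
    rcases n with _ | n
    · simp [coeff_abelSeries]
    · rw [PowerSeries.coeff_succ_X_mul, coeff_abelSeries, coeff_abelSeries, coeff_abelSeries,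
        Finset.sum_range_succ, Finset.sum_range_succ _ (n + 1), add_sub_right_comm,
        ← Finset.sum_sub_distrib, add_mul (Finset.sum _ _), Finset.sum_mul]
      congr 1
      · refine Finset.sum_congr rfl fun k hk => ?_
        have hk' : k ≤ n := by simpa [Nat.lt_succ_iff] using hk
        obtain ⟨m, rfl⟩ := Nat.exists_eq_add_of_le hk'
        rw [show k + m + 1 - k = m + 1 by omega, Nat.add_sub_cancel_left, Nat.factorial_succ,
          pow_succ]
        have h3 : (k ! : ℝ) ≠ 0 := by positivity
        have h4 : (m ! : ℝ) ≠ 0 := by positivity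
        push_cast
        field_simp
        ring
      · simp
        ring
  rw [succOp_apply, ← key, ← mul_assoc, geom_mul, one_mul]

theorem succOp_one : succOp 1 = geom := by
  simp [succOp_apply]

theorem succOp_geom_pow (m : ℕ) :
    succOp (geom ^ (m + 1)) =
      ((m : ℝ) + 1) • geom ^ (m + 3) - (m : ℝ) • geom ^ (m + 2) := by
  rw [succOp_apply, X_mul_geom_pow]
  rcases m with _ | m
  · simp [derivative_geom]; ring
  · simp only [map_sub, Derivation.leibniz_pow, derivative_geom, smul_eq_mul, nsmul_eq_mul,
      Nat.add_sub_cancel, PowerSeries.smul_eq_C_mul]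
    push_cast
    simp only [map_add, map_one, map_natCast]
    ring

/-- Up to factorials, coefficient n + 1 is the (n+1)-st difference of x^n, hence zero. -/
theorem abelSeries_succ_pow_pred :
    abelSeries (fun k => ((k : ℝ) + 1) ^ k / ((k : ℝ) + 1)) = 1 := by
  ext n
  rcases n with _ | n
  · simp [coeff_abelSeries]
  · have hf : (((n + 1)! : ℕ) : ℝ) ≠ 0 := by positivity
    rw [← mul_right_inj' hf, factorial_mul_coeff_abelSeries]
    have h := sum_neg_one_pow_choose (fun x => x ^ n) (n + 1) 1
    rw [fwdDiff_iter_pow_eq_zero_of_lt (Nat.lt_succ_self n)] at h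
    rw [PowerSeries.coeff_one, if_neg (by omega), mul_zero]
    refine Eq.trans ?_ h
    refine Finset.sum_congr rfl fun k hk => ?_
    have hk' : k ≤ n + 1 := by simpa [Nat.lt_succ_iff] using hk
    have h0 : (k : ℝ) + 1 ≠ 0 := by positivity
    have h1 : ((k : ℝ) + 1) ^ k * ((k : ℝ) + 1) ^ (n + 1 - k) = (1 + (k : ℝ)) ^ n * (k + 1) := by
      rw [← pow_add, Nat.add_sub_cancel' hk', pow_succ, add_comm 1 (k : ℝ)]
    rw [neg_pow]
    field_simp
    linear_combination (n + 1).choose k * h1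

/-- The numbers `k! * ∑ i ≤ k, (k + 1) ^ i / i!`. -/
noncomputable def ramanujanSum (k : ℕ) : ℝ :=
  (k ! : ℝ) * ∑ i ∈ Finset.range (k + 1), ((k : ℝ) + 1) ^ i / (i ! : ℝ)

/-- The m-th difference of x^m is m!, with m = n - j. -/
theorem sum_ramanujanSum_inner {n j : ℕ} (hj : j ≤ n) :
    ∑ k ∈ Finset.Ico j (n + 1), (-1) ^ (n - k) * ((k : ℝ) + 1) ^ (n - j) /
      (((k - j)! : ℝ) * ((n - k)! : ℝ)) = 1 := by
  obtain ⟨m, rfl⟩ := Nat.exists_eq_add_of_le hj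
  have h := sum_neg_one_pow_choose (fun x => x ^ m) m ((j : ℝ) + 1)
  rw [fwdDiff_iter_eq_factorial] at h
  have hm : (m ! : ℝ) ≠ 0 := by positivity
  rw [Finset.sum_Ico_eq_sum_range, ← mul_right_inj' hm, mul_one, Finset.mul_sum]
  simp only [Pi.natCast_apply] at h
  rw [show j + m + 1 - j = m + 1 by omega]
  refine Eq.trans ?_ h
  refine Finset.sum_congr rfl fun l hl => ?_
  have hl' : l ≤ m := by simpa [Nat.lt_succ_iff] using hl
  have h1 : (m.choose l : ℝ) * (l ! * (m - l)!) = m ! := by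
    rw [← mul_assoc]
    exact_mod_cast Nat.choose_mul_factorial_mul_factorial hl'
  have h3 : (l ! : ℝ) ≠ 0 := by positivity
  have h4 : ((m - l)! : ℝ) ≠ 0 := by positivity
  rw [show j + m - (j + l) = m - l by omega, Nat.add_sub_cancel_left, Nat.add_sub_cancel_left,
    ← h1]
  push_cast
  field_simp
  ring

theorem abelSeries_ramanujanSum : abelSeries ramanujanSum = geom ^ 2 := by
  have hg : geom ^ 2 = PowerSeries.mk fun n => (n : ℝ) + 1 := by
    rw [← derivative_geom]
    ext n
    simp [PowerSeries.coeff_derivative, geom]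
  rw [hg]
  ext n
  rw [coeff_abelSeries, PowerSeries.coeff_mk]
  calc _ = ∑ k ∈ Finset.range (n + 1), ∑ j ∈ Finset.range (k + 1),
        (-1) ^ (n - k) * ((k : ℝ) + 1) ^ (n - j) / (((k - j)! : ℝ) * ((n - k)! : ℝ)) := by
        refine Finset.sum_congr rfl fun k hk => ?_
        have hk' : k ≤ n := by simpa [Nat.lt_succ_iff] using hk
        have h3 : (k ! : ℝ) ≠ 0 := by positivity
        -- Reversing the inner sum makes the total exponent of k + 1 equal to n - j, independent of
        -- k, so that the sum over k is a finite difference.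
        rw [ramanujanSum, mul_div_cancel_left₀ _ h3, ← Finset.sum_range_reflect, Finset.sum_mul]
        refine Finset.sum_congr rfl fun j hj => ?_
        have hj' : j ≤ k := by simpa [Nat.lt_succ_iff] using hj
        rw [show k + 1 - 1 - j = k - j by omega, show n - j = (k - j) + (n - k) by omega, pow_add,
          neg_pow ((k : ℝ) + 1)]
        field_simp
    _ = ∑ j ∈ Finset.range (n + 1), ∑ k ∈ Finset.Ico j (n + 1),
        (-1) ^ (n - k) * ((k : ℝ) + 1) ^ (n - j) / (((k - j)! : ℝ) * ((n - k)! : ℝ)) := by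
        refine Finset.sum_comm' fun k j => ?_
        simp only [Finset.mem_range, Finset.mem_Ico]
        omega
    _ = ∑ j ∈ Finset.range (n + 1), 1 := by
        refine Finset.sum_congr rfl fun j hj => ?_
        exact sum_ramanujanSum_inner (by simpa [Nat.lt_succ_iff] using hj)
    _ = _ := by simp

/-! ### Derivatives of the recurrence at q = 1 -/

section EvalDerivative

open Polynomial

/-- The sum of the `j`-th falling factorials of `p_1 + ⋯ + p_k` over parking functions. -/
noncomputable def sumMoment (j k : ℕ) : ℝ :=
  ∑ p ∈ parkingFunctions k, (((∑ i, p i).descFactorial j : ℕ) : ℝ)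

theorem eval_iterate_derivative_sumEnumerator (j k : ℕ) :
    (derivative^[j] (sumEnumerator (X : ℝ[X]) k)).eval 1 = sumMoment j k := by
  simp only [sumEnumerator, sumMoment, Finset.prod_pow_eq_pow_sum, iterate_derivative_sum,
    eval_finsetSum]
  refine Finset.sum_congr rfl fun p _ => ?_
  rw [iterate_derivative_X_pow_eq_natCast_mul]
  simp

theorem eval_iterate_derivative_neg_sum_X_pow (j k : ℕ) :
    (derivative^[j] (-∑ i ∈ Finset.range (k + 1), (X : ℝ[X]) ^ (i + 1))).eval 1 =
      -∑ i ∈ Finset.range (k + 1), (((i + 1).descFactorial j : ℕ) : ℝ) := by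
  simp only [iterate_derivative_neg, iterate_derivative_sum, eval_neg, eval_finsetSum]
  congr 1
  refine Finset.sum_congr rfl fun i _ => ?_
  rw [iterate_derivative_X_pow_eq_natCast_mul]
  simp

theorem sum_descFactorial_zero (k : ℕ) :
    ∑ i ∈ Finset.range (k + 1), (((i + 1).descFactorial 0 : ℕ) : ℝ) = (k : ℝ) + 1 := by
  simp

theorem cast_descFactorial_three (s : ℕ) :
    ((s.descFactorial 3 : ℕ) : ℝ) = s * (s - 1) * (s - 2) := by
  rw [← descPochhammer_eval_eq_descFactorial]
  simp [descPochhammer_succ_right]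

/-- The terms are grouped by falling factorials of m, with the trivial `descFactorial 0` and `m - 0`
kept, so that each group has the shape of `factorial_mul_coeff_X_pow_mul_abelSeries`. The next two
lemmas follow the same pattern. -/
theorem eval_derivative_mul_pow (P H : ℝ[X]) (m : ℕ) (x : ℝ) :
    (derivative^[1] (P * H ^ m)).eval x =
      (derivative^[1] P).eval x * ((m.descFactorial 0 : ℕ) * H.eval x ^ (m - 0)) +
      P.eval x * (derivative^[1] H).eval x * ((m.descFactorial 1 : ℕ) * H.eval x ^ (m - 1)) := by
  simp [derivative_mul, derivative_pow]
  ring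

theorem eval_derivative_two_mul_pow (P H : ℝ[X]) (m : ℕ) (x : ℝ) :
    (derivative^[2] (P * H ^ m)).eval x =
      (derivative^[2] P).eval x * ((m.descFactorial 0 : ℕ) * H.eval x ^ (m - 0)) +
      (2 * (derivative^[1] P).eval x * (derivative^[1] H).eval x +
        P.eval x * (derivative^[2] H).eval x) *
          ((m.descFactorial 1 : ℕ) * H.eval x ^ (m - 1)) +
      P.eval x * (derivative^[1] H).eval x ^ 2 *
        ((m.descFactorial 2 : ℕ) * H.eval x ^ (m - 2)) := by
  simp [derivative_mul, derivative_pow, Nat.descFactorial_succ, Nat.sub_sub]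
  ring

theorem eval_derivative_three_mul_pow (P H : ℝ[X]) (m : ℕ) (x : ℝ) :
    (derivative^[3] (P * H ^ m)).eval x =
      (derivative^[3] P).eval x * ((m.descFactorial 0 : ℕ) * H.eval x ^ (m - 0)) +
      (3 * (derivative^[2] P).eval x * (derivative^[1] H).eval x +
        3 * (derivative^[1] P).eval x * (derivative^[2] H).eval x +
        P.eval x * (derivative^[3] H).eval x) *
          ((m.descFactorial 1 : ℕ) * H.eval x ^ (m - 1)) +
      (3 * (derivative^[1] P).eval x * (derivative^[1] H).eval x ^ 2 +
        3 * P.eval x * (derivative^[1] H).eval x * (derivative^[2] H).eval x) *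
          ((m.descFactorial 2 : ℕ) * H.eval x ^ (m - 2)) +
      P.eval x * (derivative^[1] H).eval x ^ 3 *
        ((m.descFactorial 3 : ℕ) * H.eval x ^ (m - 3)) := by
  simp [derivative_mul, derivative_pow, Nat.descFactorial_succ, Nat.sub_sub]
  ring

/-- `j`-th derivative at `1` of the signed recurrence for the sum enumerators. -/
theorem sum_choose_mul_eval_iterate_derivative (j n : ℕ) :
    ∑ k ∈ Finset.range (n + 1), (n.choose k : ℝ) *
      (derivative^[j] (sumEnumerator (X : ℝ[X]) k *
        (-∑ i ∈ Finset.range (k + 1), (X : ℝ[X]) ^ (i + 1)) ^ (n - k))).eval 1 =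
      if n = 0 ∧ j = 0 then 1 else 0 := by
  have h := congrArg (fun f : ℝ[X] => (derivative^[j] f).eval 1)
    (sum_choose_mul_sumEnumerator (X : ℝ[X]) n)
  simp only [iterate_derivative_sum, eval_finsetSum, iterate_derivative_natCast_mul, eval_mul,
    eval_natCast] at h
  rw [h]
  rcases j with _ | j
  · split_ifs <;> simp_all
  · split_ifs <;> simp_all

theorem eval_one_neg_sum (k : ℕ) :
    (-∑ i ∈ Finset.range (k + 1), (X : ℝ[X]) ^ (i + 1)).eval 1 = -((k : ℝ) + 1) := by
  have h := eval_iterate_derivative_neg_sum_X_pow 0 k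
  rwa [sum_descFactorial_zero] at h

theorem eval_derivative_neg_sum (k : ℕ) :
    (derivative^[1] (-∑ i ∈ Finset.range (k + 1), (X : ℝ[X]) ^ (i + 1))).eval 1 =
      -(((k : ℝ) + 1) * (k + 2) / 2) := by
  rw [eval_iterate_derivative_neg_sum_X_pow]
  simp only [Nat.descFactorial_one]
  congr 1
  induction k with
  | zero => norm_num
  | succ k ih =>
    rw [Finset.sum_range_succ, ih]
    push_cast
    ring

theorem eval_derivative_two_neg_sum (k : ℕ) :
    (derivative^[2] (-∑ i ∈ Finset.range (k + 1), (X : ℝ[X]) ^ (i + 1))).eval 1 =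
      -((k : ℝ) * (k + 1) * (k + 2) / 3) := by
  rw [eval_iterate_derivative_neg_sum_X_pow]
  simp only [Nat.cast_descFactorial_two]
  congr 1
  induction k with
  | zero => norm_num
  | succ k ih =>
    rw [Finset.sum_range_succ, ih]
    push_cast
    ring

theorem eval_derivative_three_neg_sum (k : ℕ) :
    (derivative^[3] (-∑ i ∈ Finset.range (k + 1), (X : ℝ[X]) ^ (i + 1))).eval 1 =
      -(((k : ℝ) - 1) * k * (k + 1) * (k + 2) / 4) := by
  rw [eval_iterate_derivative_neg_sum_X_pow]
  simp only [cast_descFactorial_three]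
  congr 1
  induction k with
  | zero => norm_num
  | succ k ih =>
    rw [Finset.sum_range_succ, ih]
    push_cast
    ring

theorem abelSeries_sumMoment_zero : abelSeries (sumMoment 0) = 1 := by
  ext n
  have hn : (n ! : ℝ) ≠ 0 := by positivity
  rw [← mul_right_inj' hn, factorial_mul_coeff_abelSeries, PowerSeries.coeff_one]
  have h := sum_choose_mul_eval_iterate_derivative 0 n
  simp only [Function.iterate_zero, id, eval_mul, eval_pow, eval_one_neg_sum, and_true] at h
  have h0 := fun k => eval_iterate_derivative_sumEnumerator 0 k
  simp only [Function.iterate_zero, id] at h0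
  simp only [h0] at h
  rw [h]
  split_ifs with h' <;> simp [h']

theorem abelSeries_sumMoment_one :
    abelSeries (sumMoment 1) + PowerSeries.X ^ 1 *
      abelSeries (fun k => sumMoment 0 k * -(((k : ℝ) + 1) * (k + 2) / 2)) = 0 := by
  ext n
  have hn : (n ! : ℝ) ≠ 0 := by positivity
  have h := sum_choose_mul_eval_iterate_derivative 1 n
  have h0 := fun k => eval_iterate_derivative_sumEnumerator 0 k
  simp only [Function.iterate_zero, id] at h0
  simp only [eval_derivative_mul_pow, h0, eval_iterate_derivative_sumEnumerator,
    eval_one_neg_sum, eval_derivative_neg_sum,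
    mul_add (Nat.cast (Nat.choose _ _) : ℝ), Finset.sum_add_distrib,
    ← factorial_mul_coeff_X_pow_mul_abelSeries] at h
  rw [← mul_right_inj' hn, map_add, mul_add]
  simpa using h

theorem abelSeries_sumMoment_two :
    abelSeries (sumMoment 2) + PowerSeries.X ^ 1 *
      abelSeries (fun k => 2 * sumMoment 1 k * -(((k : ℝ) + 1) * (k + 2) / 2) +
        sumMoment 0 k * -((k : ℝ) * (k + 1) * (k + 2) / 3)) +
      PowerSeries.X ^ 2 *
        abelSeries (fun k => sumMoment 0 k * (-(((k : ℝ) + 1) * (k + 2) / 2)) ^ 2) = 0 := by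
  ext n
  have hn : (n ! : ℝ) ≠ 0 := by positivity
  have h := sum_choose_mul_eval_iterate_derivative 2 n
  have h0 := fun k => eval_iterate_derivative_sumEnumerator 0 k
  simp only [Function.iterate_zero, id] at h0
  simp only [eval_derivative_two_mul_pow, h0, eval_iterate_derivative_sumEnumerator,
    eval_one_neg_sum, eval_derivative_neg_sum, eval_derivative_two_neg_sum,
    mul_add (Nat.cast (Nat.choose _ _) : ℝ), Finset.sum_add_distrib,
    ← factorial_mul_coeff_X_pow_mul_abelSeries] at h
  rw [← mul_right_inj' hn, map_add, map_add, mul_add, mul_add]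
  simpa using h

theorem abelSeries_sumMoment_three :
    abelSeries (sumMoment 3) + PowerSeries.X ^ 1 *
      abelSeries (fun k => 3 * sumMoment 2 k * -(((k : ℝ) + 1) * (k + 2) / 2) +
        3 * sumMoment 1 k * -((k : ℝ) * (k + 1) * (k + 2) / 3) +
        sumMoment 0 k * -(((k : ℝ) - 1) * k * (k + 1) * (k + 2) / 4)) +
      PowerSeries.X ^ 2 *
        abelSeries (fun k => 3 * sumMoment 1 k * (-(((k : ℝ) + 1) * (k + 2) / 2)) ^ 2 +
          3 * sumMoment 0 k * -(((k : ℝ) + 1) * (k + 2) / 2) *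
            -((k : ℝ) * (k + 1) * (k + 2) / 3)) +
      PowerSeries.X ^ 3 *
        abelSeries (fun k => sumMoment 0 k * (-(((k : ℝ) + 1) * (k + 2) / 2)) ^ 3) = 0 := by
  ext n
  have hn : (n ! : ℝ) ≠ 0 := by positivity
  have h := sum_choose_mul_eval_iterate_derivative 3 n
  have h0 := fun k => eval_iterate_derivative_sumEnumerator 0 k
  simp only [Function.iterate_zero, id] at h0
  simp only [eval_derivative_three_mul_pow, h0, eval_iterate_derivative_sumEnumerator,
    eval_one_neg_sum, eval_derivative_neg_sum, eval_derivative_two_neg_sum,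
    eval_derivative_three_neg_sum,
    mul_add (Nat.cast (Nat.choose _ _) : ℝ), Finset.sum_add_distrib,
    ← factorial_mul_coeff_X_pow_mul_abelSeries] at h
  rw [← mul_right_inj' hn, map_add, map_add, map_add, mul_add, mul_add, mul_add]
  simpa using h

end EvalDerivative

/-! ### Closed forms of the moments -/

section ClosedForms

set_option linter.unusedSimpArgs false

/-- The sequence `a` multiplied by the `j`-th power of `k + 1`. -/
noncomputable def powMul (j : ℕ) (a : ℕ → ℝ) (k : ℕ) : ℝ := ((k : ℝ) + 1) ^ j * a k

/-- The number `(k + 1) ^ (k - 1)` of parking functions of length `k`. -/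
noncomputable def treeNumber (k : ℕ) : ℝ := ((k : ℝ) + 1) ^ k / ((k : ℝ) + 1)

theorem abelSeries_powMul_succ (j : ℕ) (a : ℕ → ℝ) :
    abelSeries (powMul (j + 1) a) = succOp (abelSeries (powMul j a)) := by
  rw [← abelSeries_succ_mul]
  congr 1
  funext k
  simp only [powMul]
  ring

theorem powMul_zero (a : ℕ → ℝ) : powMul 0 a = a := by
  funext k
  simp [powMul]

theorem abelSeries_powMul_tree_0 : abelSeries (powMul 0 treeNumber) =
    1 := by
  rw [powMul_zero]
  exact abelSeries_succ_pow_pred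

theorem abelSeries_powMul_tree_1 : abelSeries (powMul 1 treeNumber) =
    geom := by
  rw [abelSeries_powMul_succ, abelSeries_powMul_tree_0, succOp_one]

theorem abelSeries_powMul_tree_2 : abelSeries (powMul 2 treeNumber) =
    geom ^ 3 := by
  rw [abelSeries_powMul_succ, abelSeries_powMul_tree_1]
  simpa using succOp_geom_pow 0

theorem abelSeries_powMul_tree_3 : abelSeries (powMul 3 treeNumber) =
    (3 : ℝ) • geom ^ 5 - (2 : ℝ) • geom ^ 4 := by
  rw [abelSeries_powMul_succ, abelSeries_powMul_tree_2]
  simp only [map_add, map_sub, map_smul, succOp_geom_pow, Nat.reduceAdd, Nat.cast_ofNat,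
    Nat.cast_one]
  module

theorem abelSeries_powMul_tree_4 : abelSeries (powMul 4 treeNumber) =
    (15 : ℝ) • geom ^ 7 - (20 : ℝ) • geom ^ 6 + (6 : ℝ) • geom ^ 5 := by
  rw [abelSeries_powMul_succ, abelSeries_powMul_tree_3]
  simp only [map_add, map_sub, map_smul, succOp_geom_pow, Nat.reduceAdd, Nat.cast_ofNat,
    Nat.cast_one]
  module

theorem abelSeries_powMul_tree_5 : abelSeries (powMul 5 treeNumber) =
    (105 : ℝ) • geom ^ 9 - (210 : ℝ) • geom ^ 8 + (130 : ℝ) • geom ^ 7 - (24 : ℝ) • geom ^ 6 := by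
  rw [abelSeries_powMul_succ, abelSeries_powMul_tree_4]
  simp only [map_add, map_sub, map_smul, succOp_geom_pow, Nat.reduceAdd, Nat.cast_ofNat,
    Nat.cast_one]
  module

theorem abelSeries_powMul_tree_6 : abelSeries (powMul 6 treeNumber) =
    (945 : ℝ) • geom ^ 11 - (2520 : ℝ) • geom ^ 10 + (2380 : ℝ) • geom ^ 9 - (924 : ℝ) • geom ^ 8
    + (120 : ℝ) • geom ^ 7 := by
  rw [abelSeries_powMul_succ, abelSeries_powMul_tree_5]
  simp only [map_add, map_sub, map_smul, succOp_geom_pow, Nat.reduceAdd, Nat.cast_ofNat,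
    Nat.cast_one]
  module

theorem abelSeries_powMul_ramanujan_0 : abelSeries (powMul 0 ramanujanSum) =
    geom ^ 2 := by
  rw [powMul_zero]
  exact abelSeries_ramanujanSum

theorem abelSeries_powMul_ramanujan_1 : abelSeries (powMul 1 ramanujanSum) =
    (2 : ℝ) • geom ^ 4 - geom ^ 3 := by
  rw [abelSeries_powMul_succ, abelSeries_powMul_ramanujan_0]
  simp only [map_add, map_sub, map_smul, succOp_geom_pow, Nat.reduceAdd, Nat.cast_ofNat,
    Nat.cast_one]
  module

theorem abelSeries_powMul_ramanujan_2 : abelSeries (powMul 2 ramanujanSum) =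
    (8 : ℝ) • geom ^ 6 - (9 : ℝ) • geom ^ 5 + (2 : ℝ) • geom ^ 4 := by
  rw [abelSeries_powMul_succ, abelSeries_powMul_ramanujan_1]
  simp only [map_add, map_sub, map_smul, succOp_geom_pow, Nat.reduceAdd, Nat.cast_ofNat,
    Nat.cast_one]
  module

theorem abelSeries_powMul_ramanujan_3 : abelSeries (powMul 3 ramanujanSum) =
    (48 : ℝ) • geom ^ 8 - (85 : ℝ) • geom ^ 7 + (44 : ℝ) • geom ^ 6 - (6 : ℝ) • geom ^ 5 := by
  rw [abelSeries_powMul_succ, abelSeries_powMul_ramanujan_2]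
  simp only [map_add, map_sub, map_smul, succOp_geom_pow, Nat.reduceAdd, Nat.cast_ofNat,
    Nat.cast_one]
  module

theorem abelSeries_powMul_ramanujan_4 : abelSeries (powMul 4 ramanujanSum) =
    (384 : ℝ) • geom ^ 10 - (931 : ℝ) • geom ^ 9 + (774 : ℝ) • geom ^ 8 - (250 : ℝ) • geom ^ 7 +
    (24 : ℝ) • geom ^ 6 := by
  rw [abelSeries_powMul_succ, abelSeries_powMul_ramanujan_3]
  simp only [map_add, map_sub, map_smul, succOp_geom_pow, Nat.reduceAdd, Nat.cast_ofNat,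
    Nat.cast_one]
  module

theorem sumMoment_zero : sumMoment 0 = treeNumber := by
  refine abelSeries_injective ?_
  rw [abelSeries_sumMoment_zero, ← powMul_zero treeNumber, abelSeries_powMul_tree_0]

theorem sumMoment_one (k : ℕ) : sumMoment 1 k =
    (1 / 2 * ((k : ℝ) + 1) ^ 2 + 1 / 2 * ((k : ℝ) + 1) - 1 / 2) * treeNumber k
      - 1 / 2 * ramanujanSum k := by
  have h := abelSeries_sumMoment_one
  have h1 : (fun k : ℕ => sumMoment 0 k * -(((k : ℝ) + 1) * (k + 2) / 2)) = -((1/2 : ℝ) • powMul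
      1 treeNumber) - (1/2 : ℝ) • powMul 2 treeNumber := by
    funext k
    simp only [sumMoment_zero, powMul, Pi.add_apply,
      Pi.sub_apply, Pi.neg_apply, Pi.smul_apply, smul_eq_mul]
    ring
  -- The coefficients solve a triangular system, since `powMul j treeNumber` has degree 2j - 1 in
  -- `geom` (0 for j = 0) and `powMul j ramanujanSum` has degree 2j + 2. The same holds for the next
  -- two moments.
  have h0 : sumMoment 1 = -((1/2 : ℝ) • powMul 0 treeNumber) + (1/2 : ℝ) • powMul 1 treeNumber +
      (1/2 : ℝ) • powMul 2 treeNumber - (1/2 : ℝ) • powMul 0 ramanujanSum := by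
    refine abelSeries_injective ?_
    rw [h1] at h
    simp only [map_add, map_sub, map_neg, map_smul, abelSeries_powMul_tree_0,
      abelSeries_powMul_tree_1, abelSeries_powMul_tree_2, abelSeries_powMul_tree_3,
      abelSeries_powMul_tree_4, abelSeries_powMul_tree_5, abelSeries_powMul_tree_6,
      abelSeries_powMul_ramanujan_0, abelSeries_powMul_ramanujan_1,
      abelSeries_powMul_ramanujan_2, abelSeries_powMul_ramanujan_3,
      abelSeries_powMul_ramanujan_4] at h ⊢
    simp only [pow_succ PowerSeries.X, pow_zero PowerSeries.X, one_mul, mul_assoc, mul_add,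
      mul_sub, mul_neg, mul_smul_comm, X_mul_geom_pow, X_mul_geom, pow_one, Nat.reduceAdd] at h
    linear_combination (norm := module) h
  rw [h0]
  simp only [powMul, Pi.add_apply, Pi.sub_apply, Pi.neg_apply, Pi.smul_apply, smul_eq_mul]
  ring

theorem sumMoment_two (k : ℕ) : sumMoment 2 k =
    (1 / 4 * ((k : ℝ) + 1) ^ 4 + 11 / 12 * ((k : ℝ) + 1) ^ 3 - 3 / 4 * ((k : ℝ) + 1) ^ 2
        - 13 / 12 * ((k : ℝ) + 1) + 5 / 6) * treeNumber k
      - (1 / 2 * ((k : ℝ) + 1) ^ 2 + 2 / 3 * ((k : ℝ) + 1) - 1) * ramanujanSum k := by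
  have h := abelSeries_sumMoment_two
  have h1 : (fun k : ℕ => 2 * sumMoment 1 k * -(((k : ℝ) + 1) * (k + 2) / 2) + sumMoment 0 k *
      -((k : ℝ) * (k + 1) * (k + 2) / 3)) = (5/6 : ℝ) • powMul 1 treeNumber - (4/3 : ℝ) • powMul 3
      treeNumber - (1/2 : ℝ) • powMul 4 treeNumber + (1/2 : ℝ) • powMul 1 ramanujanSum + (1/2 : ℝ) •
      powMul 2 ramanujanSum := by
    funext k
    simp only [sumMoment_zero, sumMoment_one, powMul, Pi.add_apply,
      Pi.sub_apply, Pi.neg_apply, Pi.smul_apply, smul_eq_mul]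
    ring
  have h2 : (fun k : ℕ => sumMoment 0 k * (-(((k : ℝ) + 1) * (k + 2) / 2)) ^ 2) = (1/4 : ℝ) •
      powMul 2 treeNumber + (1/2 : ℝ) • powMul 3 treeNumber + (1/4 : ℝ) • powMul 4 treeNumber := by
    funext k
    simp only [sumMoment_zero, sumMoment_one, powMul, Pi.add_apply,
      Pi.sub_apply, Pi.neg_apply, Pi.smul_apply, smul_eq_mul]
    ring
  have h0 : sumMoment 2 = (5/6 : ℝ) • powMul 0 treeNumber - (13/12 : ℝ) • powMul 1 treeNumber -
      (3/4 : ℝ) • powMul 2 treeNumber + (11/12 : ℝ) • powMul 3 treeNumber + (1/4 : ℝ) • powMul 4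
      treeNumber + (1 : ℝ) • powMul 0 ramanujanSum - (2/3 : ℝ) • powMul 1 ramanujanSum - (1/2 : ℝ) •
      powMul 2 ramanujanSum := by
    refine abelSeries_injective ?_
    rw [h1, h2] at h
    simp only [map_add, map_sub, map_neg, map_smul, abelSeries_powMul_tree_0,
      abelSeries_powMul_tree_1, abelSeries_powMul_tree_2, abelSeries_powMul_tree_3,
      abelSeries_powMul_tree_4, abelSeries_powMul_tree_5, abelSeries_powMul_tree_6,
      abelSeries_powMul_ramanujan_0, abelSeries_powMul_ramanujan_1,
      abelSeries_powMul_ramanujan_2, abelSeries_powMul_ramanujan_3,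
      abelSeries_powMul_ramanujan_4] at h ⊢
    -- X^j only multiplies powers `geom ^ m` with m ≥ j, so X disappears altogether and an identity
    -- between polynomials in `geom` is left.
    simp only [pow_succ PowerSeries.X, pow_zero PowerSeries.X, one_mul, mul_assoc, mul_add,
      mul_sub, mul_neg, mul_smul_comm, X_mul_geom_pow, X_mul_geom, pow_one, Nat.reduceAdd] at h
    linear_combination (norm := module) h
  rw [h0]
  simp only [powMul, Pi.add_apply, Pi.sub_apply, Pi.neg_apply, Pi.smul_apply, smul_eq_mul]
  ring

theorem sumMoment_three (k : ℕ) : sumMoment 3 k =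
    (1 / 8 * ((k : ℝ) + 1) ^ 6 + ((k : ℝ) + 1) ^ 5 + 1 / 192 * ((k : ℝ) + 1) ^ 4
        - 397 / 96 * ((k : ℝ) + 1) ^ 3 + 7 / 4 * ((k : ℝ) + 1) ^ 2 + 27 / 8 * ((k : ℝ) + 1) - 9 /
          4) * treeNumber k
      - (3 / 8 * ((k : ℝ) + 1) ^ 4 + 79 / 64 * ((k : ℝ) + 1) ^ 3 - 155 / 96 * ((k : ℝ) + 1) ^ 2
        - 25 / 8 * ((k : ℝ) + 1) + 3) * ramanujanSum k := by
  have h := abelSeries_sumMoment_three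
  have h1 : (fun k : ℕ => 3 * sumMoment 2 k * -(((k : ℝ) + 1) * (k + 2) / 2) + 3 * sumMoment 1 k
      * -((k : ℝ) * (k + 1) * (k + 2) / 3) + sumMoment 0 k * -(((k : ℝ) - 1) * k * (k + 1) * (k + 2)
      / 4)) = -((9/4 : ℝ) • powMul 1 treeNumber) + (9/8 : ℝ) • powMul 2 treeNumber + (17/4 : ℝ) •
      powMul 3 treeNumber - (1 : ℝ) • powMul 4 treeNumber - (9/4 : ℝ) • powMul 5 treeNumber - (3/8 :
      ℝ) • powMul 6 treeNumber - (2 : ℝ) • powMul 1 ramanujanSum - (1/2 : ℝ) • powMul 2 ramanujanSum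
      + (9/4 : ℝ) • powMul 3 ramanujanSum + (3/4 : ℝ) • powMul 4 ramanujanSum := by
    funext k
    simp only [sumMoment_zero, sumMoment_one, sumMoment_two, powMul, Pi.add_apply,
      Pi.sub_apply, Pi.neg_apply, Pi.smul_apply, smul_eq_mul]
    ring
  have h2 : (fun k : ℕ => 3 * sumMoment 1 k * (-(((k : ℝ) + 1) * (k + 2) / 2)) ^ 2 + 3 *
      sumMoment 0 k * -(((k : ℝ) + 1) * (k + 2) / 2) * -((k : ℝ) * (k + 1) * (k + 2) / 3)) =
        -((7/8 :
      ℝ) • powMul 2 treeNumber) - (7/8 : ℝ) • powMul 3 treeNumber + (5/4 : ℝ) • powMul 4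
        treeNumber +
      (13/8 : ℝ) • powMul 5 treeNumber + (3/8 : ℝ) • powMul 6 treeNumber - (3/8 : ℝ) • powMul 2
      ramanujanSum - (3/4 : ℝ) • powMul 3 ramanujanSum - (3/8 : ℝ) • powMul 4 ramanujanSum := by
    funext k
    simp only [sumMoment_zero, sumMoment_one, sumMoment_two, powMul, Pi.add_apply,
      Pi.sub_apply, Pi.neg_apply, Pi.smul_apply, smul_eq_mul]
    ring
  have h3 : (fun k : ℕ => sumMoment 0 k * (-(((k : ℝ) + 1) * (k + 2) / 2)) ^ 3) = -((1/8 : ℝ) •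
      powMul 3 treeNumber) - (3/8 : ℝ) • powMul 4 treeNumber - (3/8 : ℝ) • powMul 5 treeNumber -
        (1/8
      : ℝ) • powMul 6 treeNumber := by
    funext k
    simp only [sumMoment_zero, sumMoment_one, sumMoment_two, powMul, Pi.add_apply,
      Pi.sub_apply, Pi.neg_apply, Pi.smul_apply, smul_eq_mul]
    ring
  have h0 : sumMoment 3 = -((9/4 : ℝ) • powMul 0 treeNumber) + (27/8 : ℝ) • powMul 1 treeNumber +
      (7/4 : ℝ) • powMul 2 treeNumber - (397/96 : ℝ) • powMul 3 treeNumber + (1/192 : ℝ) • powMul 4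
      treeNumber + (1 : ℝ) • powMul 5 treeNumber + (1/8 : ℝ) • powMul 6 treeNumber - (3 : ℝ) •
        powMul
      0 ramanujanSum + (25/8 : ℝ) • powMul 1 ramanujanSum + (155/96 : ℝ) • powMul 2 ramanujanSum -
      (79/64 : ℝ) • powMul 3 ramanujanSum - (3/8 : ℝ) • powMul 4 ramanujanSum := by
    refine abelSeries_injective ?_
    rw [h1, h2, h3] at h
    simp only [map_add, map_sub, map_neg, map_smul, abelSeries_powMul_tree_0,
      abelSeries_powMul_tree_1, abelSeries_powMul_tree_2, abelSeries_powMul_tree_3,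
      abelSeries_powMul_tree_4, abelSeries_powMul_tree_5, abelSeries_powMul_tree_6,
      abelSeries_powMul_ramanujan_0, abelSeries_powMul_ramanujan_1,
      abelSeries_powMul_ramanujan_2, abelSeries_powMul_ramanujan_3,
      abelSeries_powMul_ramanujan_4] at h ⊢
    simp only [pow_succ PowerSeries.X, pow_zero PowerSeries.X, one_mul, mul_assoc, mul_add,
      mul_sub, mul_neg, mul_smul_comm, X_mul_geom_pow, X_mul_geom, pow_one, Nat.reduceAdd] at h
    linear_combination (norm := module) h
  rw [h0]
  simp only [powMul, Pi.add_apply, Pi.sub_apply, Pi.neg_apply, Pi.smul_apply, smul_eq_mul]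
  ring

end ClosedForms

/-! ### Moments of the area -/

theorem treeNumber_pos (n : ℕ) : 0 < treeNumber n := by
  unfold treeNumber
  positivity

theorem card_parkingFunctions (n : ℕ) : ((parkingFunctions n).card : ℝ) = treeNumber n := by
  rw [← sumMoment_zero]
  simp [sumMoment]

theorem expectation_area_eq_ramanujanSum (n : ℕ) :
    expectation n area = ramanujanSum n / treeNumber n / 2 - n - 1 / 2 := by
  have h := (treeNumber_pos n).ne'
  have hsum : ∑ p ∈ parkingFunctions n, area p =
      (n : ℝ) * (n + 1) / 2 * sumMoment 0 n - sumMoment 1 n := by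
    simp only [area, sumMoment, Finset.mul_sum, ← Finset.sum_sub_distrib]
    refine Finset.sum_congr rfl fun p _ => ?_
    simp
  rw [expectation, card_parkingFunctions, hsum, sumMoment_zero, sumMoment_one]
  field_simp
  ring

theorem factorialMoment_three_eq_ramanujanSum (n : ℕ) :
    factorialMoment 3 n =
      -(175 / 192) * (n : ℝ) ^ 4 - 283 / 192 * (n : ℝ) ^ 3 + 199 / 192 * (n : ℝ) ^ 2
        + 259 / 192 * (n : ℝ)
        + (15 / 32 * (n : ℝ) ^ 3 + 521 / 96 * (n : ℝ) ^ 2 + 1219 / 96 * (n : ℝ) + 743 / 96)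
          * (ramanujanSum n / treeNumber n / 2 - n - 1 / 2) := by
  have h := (treeNumber_pos n).ne'
  obtain ⟨c, hc⟩ : ∃ c : ℝ, c = (n : ℝ) * (n + 1) / 2 := ⟨_, rfl⟩
  -- With S the sum of the entries, (c-S)(c-S-1)(c-S-2) is expanded in falling factorials of S.
  have hsum : ∑ p ∈ parkingFunctions n, ∏ j ∈ Finset.range 3, (area p - (j : ℝ)) =
      (c ^ 3 - 3 * c ^ 2 + 2 * c) * sumMoment 0 n
        + (-3 * c ^ 2 + 9 * c - 6) * sumMoment 1 n + (3 * c - 6) * sumMoment 2 n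
        - sumMoment 3 n := by
    simp only [area, sumMoment, Finset.mul_sum, ← Finset.sum_sub_distrib,
      ← Finset.sum_add_distrib, ← hc]
    refine Finset.sum_congr rfl fun p _ => ?_
    rw [cast_descFactorial_three, Nat.cast_descFactorial_two, Nat.descFactorial_one,
      Nat.descFactorial_zero]
    simp only [Finset.prod_range_succ, Finset.prod_range_zero]
    push_cast
    ring
  rw [factorialMoment, expectation, card_parkingFunctions, hsum, sumMoment_zero, sumMoment_one,
    sumMoment_two, sumMoment_three, hc]
  field_simp
  ring

theorem expectation_area (n : ℕ) : expectation n area =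
    -(n : ℝ) / 2 + 1 / 2 * (((n + 1)! : ℝ) / ((n : ℝ) + 1) ^ n) *
      ∑ k ∈ Finset.range n, ((n : ℝ) + 1) ^ k / (k ! : ℝ) := by
  have h0 : (n : ℝ) + 1 ≠ 0 := by positivity
  have h1 : (n ! : ℝ) ≠ 0 := by positivity
  -- `ramanujanSum n` has one term more, k = n; it contributes (n+1)/2 and turns -n - 1/2 into -n/2.
  rw [expectation_area_eq_ramanujanSum, ramanujanSum, treeNumber, Finset.sum_range_succ,
    Nat.factorial_succ]
  push_cast
  field_simp
  ring

/-! ### Comparison of the two halves of the exponential series -/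

/-- The terms `∏ 1 / (1 + i / N)` of the upper half of the exponential series. -/
noncomputable def upperTerm (N : ℝ) (j : ℕ) : ℝ := ∏ i ∈ Finset.range j, (1 + ((i : ℝ) + 1) / N)⁻¹

/-- The terms `∏ (1 - i / N)` of the lower half of the exponential series. -/
noncomputable def lowerTerm (N : ℝ) (j : ℕ) : ℝ := ∏ i ∈ Finset.range j, (1 - ((i : ℝ) + 1) / N)

theorem upperTerm_pos {N : ℝ} (hN : 0 < N) (j : ℕ) : 0 < upperTerm N j :=
  Finset.prod_pos fun i _ => by positivity

theorem upperTerm_succ {N : ℝ} (hN : 0 < N) (j : ℕ) :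
    N * upperTerm N j = (N + (j + 1)) * upperTerm N (j + 1) := by
  rw [upperTerm, upperTerm, Finset.prod_range_succ]
  field_simp

/-- Telescoping: (j+1) u_(j+1) = N (u_j - u_(j+1)). The cubic sum below is the same with summation
by parts against j^2. -/
theorem sum_mul_upperTerm {N : ℝ} (hN : 0 < N) (M : ℕ) :
    ∑ j ∈ Finset.range (M + 1), (j : ℝ) * upperTerm N j = N * (1 - upperTerm N M) := by
  induction M with
  | zero => simp [upperTerm]
  | succ M ih =>
    rw [Finset.sum_range_succ, ih]
    push_cast
    linear_combination -upperTerm_succ hN M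

theorem sum_cube_mul_upperTerm {N : ℝ} (hN : 0 < N) (M : ℕ) :
    ∑ j ∈ Finset.range (M + 1), (j : ℝ) ^ 3 * upperTerm N j =
      N * (∑ j ∈ Finset.range M, (2 * (j : ℝ) + 1) * upperTerm N j - M ^ 2 * upperTerm N M) := by
  induction M with
  | zero => simp
  | succ M ih =>
    rw [Finset.sum_range_succ, ih, Finset.sum_range_succ _ M]
    push_cast
    linear_combination (-((M : ℝ) + 1) ^ 2) * upperTerm_succ hN M

theorem sum_mul_upperTerm_le {N : ℝ} (hN : 0 < N) (M : ℕ) :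
    ∑ j ∈ Finset.range M, (j : ℝ) * upperTerm N j ≤ N := by
  have h := sum_mul_upperTerm hN M
  rw [Finset.sum_range_succ] at h
  have h1 := (upperTerm_pos hN M).le
  have h2 : 0 ≤ (M : ℝ) * upperTerm N M := by positivity
  have h3 : 0 ≤ N * upperTerm N M := by positivity
  linarith

theorem sum_upperTerm_le {N : ℝ} (hN : 0 < N) (M : ℕ) :
    ∑ j ∈ Finset.range M, upperTerm N j ≤ N + 1 := by
  have h : ∀ M, ∑ j ∈ Finset.range M, upperTerm N j ≤
      ∑ j ∈ Finset.range M, (j : ℝ) * upperTerm N j + 1 := by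
    intro M
    rcases M with _ | M
    · simp
    · rw [Finset.sum_range_succ', Finset.sum_range_succ']
      have : ∑ j ∈ Finset.range M, upperTerm N (j + 1) ≤
          ∑ j ∈ Finset.range M, ((j + 1 : ℕ) : ℝ) * upperTerm N (j + 1) := by
        refine Finset.sum_le_sum fun j _ => le_mul_of_one_le_left (upperTerm_pos hN _).le ?_
        push_cast
        linarith [Nat.cast_nonneg (α := ℝ) j]
      simpa [upperTerm] using this
  linarith [h M, sum_mul_upperTerm_le hN M]

theorem sum_cube_mul_upperTerm_le {N : ℝ} (hN : 1 ≤ N) (M : ℕ) :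
    ∑ j ∈ Finset.range M, (j : ℝ) ^ 3 * upperTerm N j ≤ 4 * N ^ 2 := by
  have hN0 : 0 < N := by linarith
  have h := sum_cube_mul_upperTerm hN0 M
  rw [Finset.sum_range_succ] at h
  have h1 := (upperTerm_pos hN0 M).le
  have h2 : 0 ≤ (M : ℝ) ^ 3 * upperTerm N M := by positivity
  have h3 : 0 ≤ N * ((M : ℝ) ^ 2 * upperTerm N M) := by positivity
  have h4 : ∑ j ∈ Finset.range M, (2 * (j : ℝ) + 1) * upperTerm N j ≤ 4 * N := by
    have h5 : ∑ j ∈ Finset.range M, (2 * (j : ℝ) + 1) * upperTerm N j =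
        2 * ∑ j ∈ Finset.range M, (j : ℝ) * upperTerm N j +
          ∑ j ∈ Finset.range M, upperTerm N j := by
      rw [Finset.mul_sum, ← Finset.sum_add_distrib]
      exact Finset.sum_congr rfl fun j _ => by ring
    linarith [sum_mul_upperTerm_le hN0 M, sum_upperTerm_le hN0 M]
  have h6 := mul_le_mul_of_nonneg_left h4 hN0.le
  linarith

theorem lowerTerm_eq_zero {N j : ℕ} (hN : 0 < N) (hj : N ≤ j) : lowerTerm N j = 0 := by
  refine Finset.prod_eq_zero (Finset.mem_range.2 (show N - 1 < j by omega)) ?_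
  have : (N : ℝ) ≠ 0 := by positivity
  rw [Nat.cast_sub (by omega : 1 ≤ N)]
  simp [this]

theorem lowerTerm_le_upperTerm {N : ℕ} (hN : 0 < N) (j : ℕ) :
    lowerTerm N j ≤ upperTerm N j := by
  have hN' : (0 : ℝ) < N := by positivity
  rcases le_or_gt N j with hj | hj
  · rw [lowerTerm_eq_zero hN hj]
    exact (upperTerm_pos hN' j).le
  · refine Finset.prod_le_prod (fun i hi => ?_) fun i hi => ?_
    · have : (i : ℝ) + 1 ≤ N := by
        have := Finset.mem_range.1 hi
        exact_mod_cast (by omega : i + 1 ≤ N)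
      rw [sub_nonneg, div_le_one hN']
      exact this
    · have hx : 0 ≤ ((i : ℝ) + 1) / N := by positivity
      rw [← one_div, le_div_iff₀ (by positivity)]
      nlinarith

/-- Since (1 - x)(1 + x) = 1 - x^2, the ratio lower/upper loses at most x^2 = (i/N)^2 at each
factor, in total at most j^3/N^2. Once j ≥ N the lower term is 0 and j^3 ≥ N^2. -/
theorem upperTerm_sub_lowerTerm_le {N : ℕ} (hN : 0 < N) (j : ℕ) :
    upperTerm N j - lowerTerm N j ≤ (j : ℝ) ^ 3 * upperTerm N j / N ^ 2 := by
  have hN' : (0 : ℝ) < N := by positivity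
  induction j with
  | zero => simp [upperTerm, lowerTerm]
  | succ j ih =>
    have hr := upperTerm_pos hN' j
    have hr' := upperTerm_pos hN' (j + 1)
    rcases le_or_gt N (j + 1) with hj | hj
    · rw [lowerTerm_eq_zero hN hj, sub_zero, le_div_iff₀ (by positivity), mul_comm]
      refine mul_le_mul_of_nonneg_right ?_ hr'.le
      have h1 : N ^ 2 ≤ (j + 1) ^ 3 :=
        (Nat.pow_le_pow_right hN (by norm_num)).trans (Nat.pow_le_pow_left hj 3)
      exact_mod_cast h1
    · obtain ⟨x, hx⟩ : ∃ x : ℝ, x = ((j : ℝ) + 1) / N := ⟨_, rfl⟩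
      have hx0 : 0 ≤ x := by rw [hx]; positivity
      have hx1 : x ≤ 1 := by
        rw [hx, div_le_one hN']
        exact_mod_cast hj.le
      have hu : upperTerm N j = (1 + x) * upperTerm N (j + 1) := by
        have := upperTerm_succ hN' j
        rw [hx]
        field_simp
        linarith
      have hl : lowerTerm N (j + 1) = lowerTerm N j * (1 - x) := by
        rw [lowerTerm, Finset.prod_range_succ, ← lowerTerm, hx]
      obtain ⟨a, ha⟩ : ∃ a : ℝ, a = (j : ℝ) ^ 3 / N ^ 2 := ⟨_, rfl⟩
      have ha0 : 0 ≤ a := by rw [ha]; positivity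
      have hb : a + x ^ 2 ≤ (((j + 1 : ℕ) : ℝ)) ^ 3 / N ^ 2 := by
        rw [ha, hx, div_pow, ← add_div]
        refine div_le_div_of_nonneg_right ?_ (by positivity)
        push_cast
        have : (0 : ℝ) ≤ j := Nat.cast_nonneg j
        nlinarith [mul_nonneg this this]
      have ih' : (1 - a) * upperTerm N j ≤ lowerTerm N j := by
        rw [mul_div_right_comm, ← ha] at ih
        linarith
      have h1 : (1 - a) * upperTerm N j * (1 - x) ≤ lowerTerm N (j + 1) := by
        rw [hl]
        exact mul_le_mul_of_nonneg_right ih' (by linarith)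
      rw [hu] at h1
      rw [mul_div_right_comm]
      have h2 := mul_le_mul_of_nonneg_right hb hr'.le
      have h3 : 0 ≤ a * x ^ 2 * upperTerm N (j + 1) := by positivity
      nlinarith

theorem upperTerm_eq (N j : ℕ) (hN : 0 < N) :
    upperTerm N j = (N ! : ℝ) / (N : ℝ) ^ N * ((N : ℝ) ^ (j + N) / ((j + N)! : ℝ)) := by
  have hN' : (0 : ℝ) < N := by positivity
  induction j with
  | zero =>
    have : (N ! : ℝ) ≠ 0 := by positivity
    simp [upperTerm]
    field_simp
  | succ j ih =>
    have h := upperTerm_succ hN' j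
    have h1 : ((j + N)! : ℝ) ≠ 0 := by positivity
    have h2 : (N : ℝ) + (j + 1) ≠ 0 := by positivity
    rw [ih] at h
    rw [← mul_right_inj' h2, ← h, show j + 1 + N = j + N + 1 by omega, Nat.factorial_succ,
      pow_succ]
    push_cast
    have h3 : (j : ℝ) + N + 1 ≠ 0 := by positivity
    field_simp
    ring

theorem sum_lowerTerm (n : ℕ) :
    ∑ j ∈ Finset.range (n + 1), lowerTerm ((n + 1 : ℕ) : ℝ) j =
      ramanujanSum n / ((n : ℝ) + 1) ^ n := by
  have key : ∀ j ≤ n, lowerTerm ((n + 1 : ℕ) : ℝ) j =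
      (n ! : ℝ) * (((n : ℝ) + 1) ^ (n - j) / ((n - j)! : ℝ)) / ((n : ℝ) + 1) ^ n := by
    intro j hj
    have h0 : (n : ℝ) + 1 ≠ 0 := by positivity
    induction j with
    | zero =>
      have : (n ! : ℝ) ≠ 0 := by positivity
      simp [lowerTerm]
      field_simp
    | succ j ih =>
      obtain ⟨m, rfl⟩ := Nat.exists_eq_add_of_le hj
      have h1 := ih (by omega)
      rw [show j + 1 + m - j = m + 1 by omega, Nat.factorial_succ, pow_succ] at h1
      rw [lowerTerm, Finset.prod_range_succ, ← lowerTerm, h1, Nat.add_sub_cancel_left]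
      push_cast at h0 ⊢
      have h2 : (m ! : ℝ) ≠ 0 := by positivity
      have h3 : (m : ℝ) + 1 ≠ 0 := by positivity
      field_simp
      ring
  rw [Finset.sum_congr rfl fun j hj => key j (by simpa [Nat.lt_succ_iff] using hj),
    ← Finset.sum_div, ← Finset.mul_sum, ramanujanSum, ← Finset.sum_range_reflect]
  congr 2
  refine Finset.sum_congr rfl fun j hj => ?_
  have hj' : j ≤ n := by simpa [Nat.lt_succ_iff] using hj
  rw [show n - (n + 1 - 1 - j) = j by omega]

theorem abs_two_mul_ramanujanSum_sub_le (n : ℕ) :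
    |2 * (ramanujanSum n / ((n : ℝ) + 1) ^ n) -
      ((n + 1)! : ℝ) / ((n : ℝ) + 1) ^ (n + 1) * Real.exp ((n : ℝ) + 1)| ≤ 4 := by
  have hN : 0 < n + 1 := n.succ_pos
  have hN' : (0 : ℝ) < ((n + 1 : ℕ) : ℝ) := by positivity
  have hcast : ((n + 1 : ℕ) : ℝ) = (n : ℝ) + 1 := by push_cast; ring
  set c : ℝ := ((n + 1)! : ℝ) / ((n + 1 : ℕ) : ℝ) ^ (n + 1) with hc
  have hexp : HasSum (fun k : ℕ => ((n + 1 : ℕ) : ℝ) ^ k / (k ! : ℝ))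
      (Real.exp ((n + 1 : ℕ) : ℝ)) := by
    rw [Real.exp_eq_exp_ℝ]
    exact NormedSpace.expSeries_div_hasSum_exp _
  -- The upper terms are c N^k/k! for k ≥ N = n + 1, and the lower ones the same for k ≤ n; together
  -- they sum to c e^N.
  have hr : HasSum (upperTerm ((n + 1 : ℕ) : ℝ)) (c * (Real.exp ((n + 1 : ℕ) : ℝ) -
      ∑ k ∈ Finset.range (n + 1), ((n + 1 : ℕ) : ℝ) ^ k / (k ! : ℝ))) := by
    have h1 := ((hasSum_nat_add_iff' (n + 1)).2 hexp).mul_left c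
    rwa [show upperTerm ((n + 1 : ℕ) : ℝ) = _ from funext fun j => upperTerm_eq (n + 1) j hN]
  have hlow : c * ∑ k ∈ Finset.range (n + 1), ((n + 1 : ℕ) : ℝ) ^ k / (k ! : ℝ) =
      ramanujanSum n / ((n : ℝ) + 1) ^ n := by
    have h0 : (n : ℝ) + 1 ≠ 0 := by positivity
    rw [hc, hcast, ramanujanSum, Nat.factorial_succ]
    push_cast
    field_simp
    ring
  have hq : HasSum (lowerTerm ((n + 1 : ℕ) : ℝ)) (ramanujanSum n / ((n : ℝ) + 1) ^ n) := by
    rw [← sum_lowerTerm]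
    refine hasSum_sum_of_ne_finset_zero fun j hj => lowerTerm_eq_zero hN ?_
    simpa using hj
  have hd := hr.sub hq
  have h1 : 0 ≤ c * (Real.exp ((n + 1 : ℕ) : ℝ) -
      ∑ k ∈ Finset.range (n + 1), ((n + 1 : ℕ) : ℝ) ^ k / (k ! : ℝ)) -
      ramanujanSum n / ((n : ℝ) + 1) ^ n :=
    hd.nonneg fun j => sub_nonneg.2 (lowerTerm_le_upperTerm hN j)
  have h2 : c * (Real.exp ((n + 1 : ℕ) : ℝ) -
      ∑ k ∈ Finset.range (n + 1), ((n + 1 : ℕ) : ℝ) ^ k / (k ! : ℝ)) -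
      ramanujanSum n / ((n : ℝ) + 1) ^ n ≤ 4 := by
    refine le_of_tendsto' hd.tendsto_sum_nat fun M => ?_
    refine (Finset.sum_le_sum fun j _ => upperTerm_sub_lowerTerm_le hN j).trans ?_
    rw [← Finset.sum_div, div_le_iff₀ (by positivity)]
    refine sum_cube_mul_upperTerm_le ?_ M
    exact_mod_cast hN
  rw [mul_sub, hlow] at h1 h2
  rw [← hcast, ← hc, abs_le]
  rw [← hcast] at h1 h2
  constructor <;> linarith

/-! ### Stirling's formula with an explicit error -/

theorem stirlingSeq_le {n : ℕ} (hn : n ≠ 0) :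
    Stirling.stirlingSeq n ≤ Real.sqrt Real.pi * Real.exp (1 / (12 * n)) := by
  obtain ⟨m, rfl⟩ := Nat.exists_eq_succ_of_ne_zero hn
  have hpi : 0 < Real.sqrt Real.pi := Real.sqrt_pos.2 Real.pi_pos
  -- The step bound on log `stirlingSeq` telescopes to 1/(12k), so this sequence increases to its
  -- limit log √π.
  have hmono : Monotone fun k : ℕ =>
      Real.log (Stirling.stirlingSeq (k + 1)) - 1 / (12 * ((k + 1 : ℕ) : ℝ)) := by
    refine monotone_nat_of_le_succ fun k => ?_
    have h := Stirling.log_stirlingSeq_sdiff_le (k + 1)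
    have h1 : (1 : ℝ) / (12 * ((k + 1 : ℕ) : ℝ) * (((k + 1 : ℕ) : ℝ) + 1)) =
        1 / (12 * ((k + 1 : ℕ) : ℝ)) - 1 / (12 * ((k + 1 + 1 : ℕ) : ℝ)) := by
      push_cast
      field_simp
      ring
    rw [h1] at h
    linarith
  have h1 : Tendsto (fun k : ℕ => Real.log (Stirling.stirlingSeq (k + 1))) atTop
      (nhds (Real.log (Real.sqrt Real.pi))) :=
    (Stirling.tendsto_stirlingSeq_sqrt_pi.comp (tendsto_add_atTop_nat 1)).log hpi.ne'
  have h2 : Tendsto (fun k : ℕ => (1 : ℝ) / (12 * ((k + 1 : ℕ) : ℝ))) atTop (nhds 0) := by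
    have h3 := (tendsto_one_div_add_atTop_nhds_zero_nat (𝕜 := ℝ)).const_mul (1 / 12)
    rw [mul_zero] at h3
    refine h3.congr fun k => ?_
    push_cast
    field_simp
  have hlim := h1.sub h2
  rw [sub_zero] at hlim
  have hle := hmono.ge_of_tendsto hlim m
  rw [← Real.log_le_log_iff (Stirling.stirlingSeq'_pos m) (by positivity),
    Real.log_mul hpi.ne' (Real.exp_pos _).ne', Real.log_exp]
  simp only [Nat.succ_eq_add_one] at hle ⊢
  linarith

theorem abs_factorial_mul_exp_sub_le {N : ℕ} (hN : N ≠ 0) :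
    |(N ! : ℝ) / (N : ℝ) ^ N * Real.exp N - Real.sqrt (2 * Real.pi) * Real.sqrt N| ≤ 1 := by
  have hN1 : (1 : ℝ) ≤ N := by exact_mod_cast Nat.one_le_iff_ne_zero.2 hN
  have hN0 : (0 : ℝ) < N := by linarith
  set s := Real.sqrt N with hs
  have hs0 : 0 < s := Real.sqrt_pos.2 hN0
  have hs1 : 1 ≤ s := Real.one_le_sqrt.2 hN1
  have hss : s * s = N := Real.mul_self_sqrt hN0.le
  have h2 : 0 < Real.sqrt 2 := by positivity
  have hpi : 0 < Real.sqrt Real.pi := Real.sqrt_pos.2 Real.pi_pos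
  have hst : (N ! : ℝ) / (N : ℝ) ^ N * Real.exp N =
      Stirling.stirlingSeq N * (Real.sqrt 2 * s) := by
    rw [Stirling.stirlingSeq, Real.sqrt_mul (by norm_num), ← hs, div_pow, ← Real.exp_nat_mul,
      mul_one]
    field_simp
  have hlow := Stirling.sqrt_pi_le_stirlingSeq hN
  have hup := stirlingSeq_le hN
  have hx : (1 : ℝ) / (12 * N) ≤ 1 / 12 := by
    rw [div_le_div_iff₀ (by positivity) (by norm_num)]
    linarith
  have hx0 : (0 : ℝ) < 1 / (12 * N) := by positivity
  -- From (1 - y) e^y ≤ 1 with y ≤ 1/12.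
  have hexp : Real.exp (1 / (12 * N)) ≤ 1 + 2 * (1 / (12 * N)) := by
    have h := Real.add_one_le_exp (-(1 / (12 * (N : ℝ))))
    rw [Real.exp_neg] at h
    have h3 := Real.exp_pos (1 / (12 * (N : ℝ)))
    have h4 : (-(1 / (12 * (N : ℝ))) + 1) * Real.exp (1 / (12 * N)) ≤ 1 := by
      have := mul_le_mul_of_nonneg_right h h3.le
      rwa [inv_mul_cancel₀ h3.ne'] at this
    nlinarith
  have h2pi : Real.sqrt 2 * Real.sqrt Real.pi ≤ 3 := by
    rw [← Real.sqrt_mul (by norm_num), Real.sqrt_le_left (by norm_num)]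
    linarith [Real.pi_le_four]
  have hprod : 0 < Real.sqrt 2 * s := by positivity
  rw [hst, Real.sqrt_mul (by norm_num), abs_le]
  have h5 : Real.sqrt Real.pi * (Real.sqrt 2 * s) ≤ Stirling.stirlingSeq N * (Real.sqrt 2 * s) :=
    mul_le_mul_of_nonneg_right hlow hprod.le
  have h6 : Stirling.stirlingSeq N * (Real.sqrt 2 * s) ≤
      Real.sqrt Real.pi * (1 + 2 * (1 / (12 * N))) * (Real.sqrt 2 * s) :=
    mul_le_mul_of_nonneg_right
      (hup.trans (mul_le_mul_of_nonneg_left hexp hpi.le)) hprod.le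
  have h7 : Real.sqrt Real.pi * (2 * (1 / (12 * N))) * (Real.sqrt 2 * s) ≤ 1 := by
    have h8 : Real.sqrt Real.pi * (2 * (1 / (12 * N))) * (Real.sqrt 2 * s) =
        Real.sqrt 2 * Real.sqrt Real.pi / (6 * s) := by
      rw [← hss]
      field_simp
      norm_num
    rw [h8, div_le_one (by positivity)]
    linarith
  constructor <;> nlinarith

/-! ### Asymptotics of the first and third moments -/

theorem ramanujanSum_div_treeNumber (n : ℕ) : ramanujanSum n / treeNumber n =
    ((n : ℝ) + 1) * (ramanujanSum n / ((n : ℝ) + 1) ^ n) := by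
  rw [treeNumber]
  field_simp

theorem abs_expectation_area_sub_le {n : ℕ} (hn : 1 ≤ n) :
    |expectation n area - Real.sqrt (2 * Real.pi) / 4 * ((n : ℝ) * Real.sqrt n)| ≤
      10 * (n : ℝ) := by
  have hn' : (1 : ℝ) ≤ n := by exact_mod_cast hn
  have h1 := abs_two_mul_ramanujanSum_sub_le n
  have h2 := abs_factorial_mul_exp_sub_le n.succ_ne_zero
  rw [expectation_area_eq_ramanujanSum, ramanujanSum_div_treeNumber]
  set Q := ramanujanSum n / ((n : ℝ) + 1) ^ n
  have hcast : ((n.succ : ℕ) : ℝ) = (n : ℝ) + 1 := by push_cast; ring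
  rw [hcast, Nat.succ_eq_add_one] at h2
  set F := ((n + 1)! : ℝ) / ((n : ℝ) + 1) ^ (n + 1) * Real.exp ((n : ℝ) + 1)
  set c := Real.sqrt (2 * Real.pi)
  set s := Real.sqrt n with hs
  set t := Real.sqrt ((n : ℝ) + 1) with ht
  have hc0 : 0 ≤ c := Real.sqrt_nonneg _
  have hc3 : c ≤ 3 := by
    rw [Real.sqrt_le_left (by norm_num)]
    linarith [Real.pi_le_four]
  have hss : s * s = n := Real.mul_self_sqrt (by linarith)
  have htt : t * t = n + 1 := Real.mul_self_sqrt (by linarith)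
  have hs1 : 1 ≤ s := Real.one_le_sqrt.2 hn'
  have hst : s ≤ t := Real.sqrt_le_sqrt (by linarith)
  have hts : t ≤ s + 1 := by nlinarith
  -- From (t - s)(t + s) = 1: replacing √(n+1) by √n costs only O(n) in the end.
  have hd : 0 ≤ t - s ∧ (t - s) * s ≤ 1 := by
    refine ⟨by linarith, ?_⟩
    nlinarith
  have hsn : s ≤ n := by nlinarith
  have h3 : |2 * Q - c * t| ≤ 5 := by
    calc |2 * Q - c * t| = |(2 * Q - F) + (F - c * t)| := by ring_nf
      _ ≤ |2 * Q - F| + |F - c * t| := abs_add_le _ _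
      _ ≤ 5 := by linarith
  have h4 : 0 ≤ ((n : ℝ) + 1) * t - n * s ∧ ((n : ℝ) + 1) * t - n * s ≤ 3 * n := by
    have h5 : ((n : ℝ) + 1) * t - n * s = n * (t - s) + t := by ring
    rw [h5]
    constructor
    · have := mul_nonneg (by linarith : (0 : ℝ) ≤ n) hd.1
      linarith
    · nlinarith
  have h6 : (((n : ℝ) + 1) * Q / 2 - n - 1 / 2) - c / 4 * (n * s) =
      ((n : ℝ) + 1) / 4 * (2 * Q - c * t) + c / 4 * (((n : ℝ) + 1) * t - n * s) - n - 1 / 2 := by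
    ring
  have h7 : |((n : ℝ) + 1) / 4 * (2 * Q - c * t)| ≤ ((n : ℝ) + 1) / 4 * 5 := by
    rw [abs_mul, abs_of_nonneg (by positivity)]
    exact mul_le_mul_of_nonneg_left h3 (by positivity)
  have h8 : c / 4 * (((n : ℝ) + 1) * t - n * s) ≤ 3 / 4 * (3 * n) :=
    mul_le_mul (by linarith) h4.2 h4.1 (by norm_num)
  have h9 : 0 ≤ c / 4 * (((n : ℝ) + 1) * t - n * s) := mul_nonneg (by linarith) h4.1
  rw [h6]
  rw [abs_le] at h7 ⊢
  constructor <;> linarith [h7.1, h7.2]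

theorem rpow_nine_halves {x : ℝ} (hx : 0 < x) : x ^ (9 / 2 : ℝ) = x ^ 4 * Real.sqrt x := by
  rw [Real.sqrt_eq_rpow, ← Real.rpow_natCast, ← Real.rpow_add hx]
  norm_num

theorem factorialMoment_three (n : ℕ) : factorialMoment 3 n =
    -(175 / 192) * (n : ℝ) ^ 4 - 283 / 192 * (n : ℝ) ^ 3 + 199 / 192 * (n : ℝ) ^ 2
      + 259 / 192 * (n : ℝ)
      + (15 / 32 * (n : ℝ) ^ 3 + 521 / 96 * (n : ℝ) ^ 2 + 1219 / 96 * (n : ℝ) + 743 / 96)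
        * expectation n area := by
  rw [factorialMoment_three_eq_ramanujanSum, expectation_area_eq_ramanujanSum]

theorem abs_factorialMoment_three_sub_le {n : ℕ} (hn : 1 ≤ n) :
    |factorialMoment 3 n - 15 / 128 * Real.sqrt (2 * Real.pi) * (n : ℝ) ^ (9 / 2 : ℝ)| ≤
      1000 * (n : ℝ) ^ 4 := by
  have hn' : (1 : ℝ) ≤ n := by exact_mod_cast hn
  have h := abs_expectation_area_sub_le hn
  rw [factorialMoment_three, rpow_nine_halves (by linarith)]
  set x := (n : ℝ)
  set E := expectation n area
  set c := Real.sqrt (2 * Real.pi)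
  set s := Real.sqrt x
  obtain ⟨d, hd⟩ : ∃ d, d = E - c / 4 * (x * s) := ⟨_, rfl⟩
  rw [← hd] at h
  have hE : E = c / 4 * (x * s) + d := by linarith
  have hc0 : 0 ≤ c := Real.sqrt_nonneg _
  have hc3 : c ≤ 3 := by
    rw [Real.sqrt_le_left (by norm_num)]
    linarith [Real.pi_le_four]
  have hss : s * s = x := Real.mul_self_sqrt (by linarith)
  have hs1 : 1 ≤ s := Real.one_le_sqrt.2 hn'
  have hsx : s ≤ x := by nlinarith
  have hx12 : x ≤ x ^ 2 := by nlinarith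
  have hEabs : |E| ≤ 11 * x ^ 2 := by
    have h1 : 0 ≤ c / 4 * (x * s) := by positivity
    have h2 : c / 4 * (x * s) ≤ 3 / 4 * (x * x) :=
      mul_le_mul (by linarith) (mul_le_mul_of_nonneg_left hsx (by linarith)) (by positivity)
        (by norm_num)
    rw [abs_le] at h ⊢
    constructor <;> nlinarith [h.1, h.2]
  -- Only 15/32 x^3 times the main term of E reaches order 9/2, with 15/32 · 1/4 = 15/128;
  -- everything else is O(x^4).
  have h0 : -(175 / 192) * x ^ 4 - 283 / 192 * x ^ 3 + 199 / 192 * x ^ 2 + 259 / 192 * x +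
      (15 / 32 * x ^ 3 + 521 / 96 * x ^ 2 + 1219 / 96 * x + 743 / 96) * E -
      15 / 128 * c * (x ^ 4 * s) =
      (-(175 / 192) * x ^ 4 - 283 / 192 * x ^ 3 + 199 / 192 * x ^ 2 + 259 / 192 * x) +
      15 / 32 * x ^ 3 * d + (521 / 96 * x ^ 2 + 1219 / 96 * x + 743 / 96) * E := by
    rw [hE]
    ring
  have hx24 : x ^ 2 ≤ x ^ 4 := pow_le_pow_right₀ hn' (by norm_num)
  have hx34 : x ^ 3 ≤ x ^ 4 := pow_le_pow_right₀ hn' (by norm_num)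
  have hx14 : x ≤ x ^ 4 := hx12.trans hx24
  have hx2 : 1 ≤ x ^ 2 := one_le_pow₀ hn'
  have hx3 : 0 ≤ x ^ 3 := by positivity
  have h1 : |15 / 32 * x ^ 3 * d| ≤ 15 / 32 * x ^ 3 * (10 * x) := by
    rw [abs_mul, abs_of_nonneg (by positivity)]
    exact mul_le_mul_of_nonneg_left h (by positivity)
  have h2 : |(521 / 96 * x ^ 2 + 1219 / 96 * x + 743 / 96) * E| ≤ 30 * x ^ 2 * (11 * x ^ 2) := by
    rw [abs_mul, abs_of_nonneg (by positivity)]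
    exact mul_le_mul (by linarith) hEabs (abs_nonneg _) (by positivity)
  rw [h0]
  rw [abs_le] at h1 h2 ⊢
  constructor <;> nlinarith [h1.1, h1.2, h2.1, h2.2]

end ParkingArea

theorem theorem3 :
    -- the expectation `E_1(n)` of the area, explicitly
    (∀ n : ℕ, ParkingArea.expectation n ParkingArea.area =
      -(n : ℝ) / 2 + 1 / 2 * (((n + 1)! : ℝ) / ((n : ℝ) + 1) ^ n) *
        ∑ k ∈ Finset.range n, ((n : ℝ) + 1) ^ k / (k ! : ℝ)) ∧
    -- the third factorial moment in terms of `E_1(n)`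
    (∀ n : ℕ, ParkingArea.factorialMoment 3 n =
      -(175 / 192) * (n : ℝ) ^ 4 - 283 / 192 * (n : ℝ) ^ 3 + 199 / 192 * (n : ℝ) ^ 2
        + 259 / 192 * (n : ℝ)
        + (15 / 32 * (n : ℝ) ^ 3 + 521 / 96 * (n : ℝ) ^ 2 + 1219 / 96 * (n : ℝ) + 743 / 96)
          * ParkingArea.expectation n ParkingArea.area) ∧
    -- its asymptotics
    ((fun n : ℕ => ParkingArea.factorialMoment 3 n
        - 15 / 128 * Real.sqrt (2 * Real.pi) * (n : ℝ) ^ (9 / 2 : ℝ))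
      =O[atTop] fun n : ℕ => (n : ℝ) ^ 4) := by
  refine ⟨ParkingArea.expectation_area, ParkingArea.factorialMoment_three,
    IsBigO.of_bound 1000 ?_⟩
  filter_upwards [eventually_ge_atTop 1] with n hn
  rw [Real.norm_eq_abs, Real.norm_of_nonneg (by positivity)]
  exact ParkingArea.abs_factorialMoment_three_sub_le hn
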